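/- Let $(\mathcal{A},\mathcal{H},D)$ be a spectral triple: $\mathcal{H}$ is a complex Hilbert space, $\mathcal{A}\subset B(\mathcal{H})$ is a unital (real or complex) $*$-subalgebra, and $D$ is a self-adjoint operator on $\mathcal{H}$ with compact resolvent such that, for every $a\in\mathcal{A}$, $a$ maps $\operatorname{dom}D$ into itself and $[D,a]$ extends to a bounded operator. Put $\mathcal{H}^{\infty}=\bigcap_{k}\operatorname{dom}D^{k}$, and let $\operatorname{End}_{\mathcal{A}}(\mathcal{H}^{\infty})$ be the algebra of ($\mathbb{C}$-)linear operators on $\mathcal{H}^\infty$ that commute with $\mathcal{A}$. The triple is called \emph{regular} if $\mathcal{A}+[D,\mathcal{A}]\subset\bigcap_{k}\operatorname{dom}\delta^{k}$, where $\delta(T)=[|D|,T]$ is the derivation whose domain consists of those $T\in B(\mathcal{H})$ that map $\operatorname{dom}|D|$ into itself and for which $[|D|,T]$ extends to a bounded operator. It is called \emph{strongly regular} if, in addition, every element of $\operatorname{End}_{\mathcal{A}}(\mathcal{H}^{\infty})$ extends to a bounded operator on $\mathcal{H}$ and $\operatorname{End}_{\mathcal{A}}(\mathcal{H}^{\infty})\subset\bigcap_{k}\operatorname{dom}\delta^{k}$.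 If the triple is regular, each $a\in\mathcal{A}$ maps $\mathcal{H}^{\infty}$ to itself, and the [extended] algebra of differential operators $\mathcal{D}$ of $(\mathcal{A},\mathcal{H},D)$ is the algebra of linear operators on $\mathcal{H}^{\infty}$ built from the following pieces: $\mathcal{D}_{0}$ is the complex algebra generated by $\mathcal{A}$ and $[D,\mathcal{A}]$ [and $\operatorname{End}_{\mathcal{A}}(\mathcal{H}^{\infty})$], and for $k\geq 1$ \[ \mathcal{D}_{k}=\sum_{j=1}^{k-1}\mathcal{D}_{j}\mathcal{D}_{k-j}+[D^{2},\mathcal{D}_{k-1}]+\mathcal{D}_{0}[D^{2},\mathcal{D}_{k-1}]. \] Write $\mathcal{D}_{\leq k}=\sum_{j=0}^{k}\mathcal{D}_{j}$ for the resulting increasing filtration by order. Let $M\in B(\mathcal{H})$ be self-adjoint, and let $D_{M}=D+M$ with domain $\operatorname{dom}D$. Suppose that $(\mathcal{A},\mathcal{H},D)$ is [strongly] regular with [extended] algebra of differential operators $\mathcal{D}$, that $M$ maps $\mathcal{H}^{\infty}$ to itself with $M|_{\mathcal{H}^{\infty}}\in\mathcal{D}_{0}$, and that, as operators on $\mathcal{H}^\infty$,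 $[D_{M}^{2}-D^{2},T]\in\mathcal{D}_{\leq k+1}$ for every $k\geq 0$ and every $T\in\mathcal{D}_{\leq k}$. Then $(\mathcal{A},\mathcal{H},D_{M})$ is also a [strongly] regular spectral triple. The statement holds in both versions: the one with all bracketed words omitted, and the one with all bracketed words included. -/

import Mathlib

open scoped InnerProductSpace

noncomputable section

namespace NCG

variable {H : Type*} [NormedAddCommGroup H] [InnerProductSpace ℂ H] [CompleteSpace H]

/-! ### The modulus of an unbounded self-adjoint operator -/

/-- The closure of the graph of `D`, as a closed subspace of the Hilbert space `H ⊕ H`. -/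
def closedGraph (D : H →ₗ.[ℂ] H) : Submodule ℂ (WithLp 2 (H × H)) :=
  (D.graph.map (WithLp.linearEquiv 2 ℂ (H × H)).symm.toLinearMap).topologicalClosure

instance (D : H →ₗ.[ℂ] H) : CompleteSpace (closedGraph D) :=
  inferInstanceAs (CompleteSpace (Submodule.topologicalClosure _))

/-- The bounded operator `(1 + D²)⁻¹` for `D` self-adjoint, obtained as the upper left corner of
the orthogonal projection of `H ⊕ H` onto the graph of `D`. -/
def resolventSq (D : H →ₗ.[ℂ] H) : H →L[ℂ] H :=
  (WithLp.fstL 2 ℂ H H) ∘L (closedGraph D).starProjection ∘L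
    (WithLp.prodContinuousLinearEquiv 2 ℂ H H).symm.toContinuousLinearMap ∘L
      (ContinuousLinearMap.inl ℂ H H)

/-- The modulus `|D|` of a self-adjoint operator `D`: with `R = (1 + D²)⁻¹`, it is the operator
with domain `ran R^{1/2}` that sends `R^{1/2} x` to `(1 - R)^{1/2} x`. By `modulus_spec` it is the
positive self-adjoint square root of `D²`. -/
def modulus (D : H →ₗ.[ℂ] H) : H →ₗ.[ℂ] H :=
  (LinearMap.range ((CFC.sqrt (resolventSq D)).prod
    (CFC.sqrt (1 - resolventSq D))).toLinearMap).toLinearPMap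

section ModulusSpec

variable {D : H →ₗ.[ℂ] H}

theorem mem_closedGraph (hD : IsSelfAdjoint D) (z : WithLp 2 (H × H)) :
    z ∈ closedGraph D ↔ (z.fst, z.snd) ∈ D.graph := by
  have hcl : IsClosed (D.graph : Set (H × H)) := hD.isClosed
  have : closedGraph D = D.graph.map (WithLp.linearEquiv 2 ℂ (H × H)).symm.toLinearMap := by
    apply IsClosed.submodule_topologicalClosure_eq
    have : ((D.graph.map (WithLp.linearEquiv 2 ℂ (H × H)).symm.toLinearMap : Submodule _ _) :
        Set (WithLp 2 (H × H))) = (WithLp.prodContinuousLinearEquiv 2 ℂ H H) ⁻¹' D.graph := by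
      ext w
      constructor
      · rintro ⟨y, hy, rfl⟩
        exact hy
      · intro hw
        exact ⟨_, hw, rfl⟩
    rw [this]
    exact hcl.preimage (ContinuousLinearEquiv.continuous _)
  rw [this]
  constructor
  · rintro ⟨y, hy, rfl⟩
    exact hy
  · intro hw
    exact ⟨_, hw, rfl⟩

theorem mem_graph_of_forall (hD : IsSelfAdjoint D) {x y : H}
    (h : ∀ a b, (a, b) ∈ D.graph → ⟪b, x⟫_ℂ = ⟪a, y⟫_ℂ) : (x, y) ∈ D.graph := by
  rw [← LinearPMap.isSelfAdjoint_def.mp hD,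
    LinearPMap.adjoint_graph_eq_graph_adjoint hD.dense_domain, Submodule.mem_adjoint_iff]
  intro a b hab
  exact sub_eq_zero.mpr (h a b hab)

theorem inner_graph_symm (hD : IsSelfAdjoint D) {x y a b : H} (h : (x, y) ∈ D.graph)
    (hab : (a, b) ∈ D.graph) : ⟪b, x⟫_ℂ = ⟪a, y⟫_ℂ := by
  rw [← LinearPMap.isSelfAdjoint_def.mp hD,
    LinearPMap.adjoint_graph_eq_graph_adjoint hD.dense_domain, Submodule.mem_adjoint_iff] at h
  exact sub_eq_zero.mp (h a b hab)

theorem resolventSq_spec (hD : IsSelfAdjoint D) (x : H) :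
    ∃ y, (resolventSq D x, y) ∈ D.graph ∧ (y, x - resolventSq D x) ∈ D.graph := by
  set p := (closedGraph D).starProjection (WithLp.toLp 2 (x, 0)) with hp
  have hR : resolventSq D x = p.fst := rfl
  refine ⟨p.snd, ?_, ?_⟩
  · rw [hR]
    exact (mem_closedGraph hD p).mp (Submodule.starProjection_apply_mem _ _)
  · rw [hR]
    apply mem_graph_of_forall hD
    intro a b hab
    have h1 := Submodule.starProjection_inner_eq_zero (K := closedGraph D)
      (WithLp.toLp 2 (x, 0)) (WithLp.toLp 2 (a, b)) ((mem_closedGraph hD _).mpr hab)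
    rw [← hp] at h1
    have h2 : ⟪x - p.fst, a⟫_ℂ + ⟪0 - p.snd, b⟫_ℂ = 0 := h1
    rw [zero_sub, inner_neg_left, ← sub_eq_add_neg, sub_eq_zero] at h2
    rw [← inner_conj_symm, ← h2, inner_conj_symm]

theorem resolventSq_unique (hD : IsSelfAdjoint D) {u v w : H} (h1 : (u, v) ∈ D.graph)
    (h2 : (v, w) ∈ D.graph) : resolventSq D (u + w) = u := by
  obtain ⟨y, h3, h4⟩ := resolventSq_spec hD (u + w)
  set r := resolventSq D (u + w)
  have e1 : (r - u, y - v) ∈ D.graph := D.graph.sub_mem h3 h1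
  have e2 : (y - v, u + w - r - w) ∈ D.graph := D.graph.sub_mem h4 h2
  have e3 := inner_graph_symm hD e1 e2
  have e4 : u + w - r - w = -(r - u) := by abel
  rw [e4, inner_neg_left] at e3
  have e5 := congrArg Complex.re e3
  rw [Complex.neg_re] at e5
  have p1 : 0 ≤ (⟪r - u, r - u⟫_ℂ).re := inner_self_nonneg (𝕜 := ℂ)
  have p2 : 0 ≤ (⟪y - v, y - v⟫_ℂ).re := inner_self_nonneg (𝕜 := ℂ)
  have p3 : (⟪r - u, r - u⟫_ℂ).re = 0 := by linarith
  have p4 : ‖r - u‖ ^ 2 = 0 := by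
    rw [← inner_self_eq_norm_sq (𝕜 := ℂ)]
    exact p3
  exact sub_eq_zero.mp (norm_eq_zero.mp (pow_eq_zero_iff two_ne_zero |>.mp p4))

theorem inner_resolventSq (x y : H) :
    ⟪resolventSq D x, y⟫_ℂ =
      ⟪(closedGraph D).starProjection (WithLp.toLp 2 (x, 0)), WithLp.toLp 2 (y, 0)⟫_ℂ := by
  rw [WithLp.prod_inner_apply]
  simp [resolventSq]

theorem resolventSq_nonneg : 0 ≤ resolventSq D := by
  rw [ContinuousLinearMap.nonneg_iff_isPositive, ContinuousLinearMap.isPositive_def]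
  constructor
  · intro x y
    change ⟪resolventSq D x, y⟫_ℂ = ⟪x, resolventSq D y⟫_ℂ
    rw [← inner_conj_symm x, inner_resolventSq, inner_resolventSq, inner_conj_symm,
      Submodule.inner_starProjection_left_eq_right]
  · intro x
    change 0 ≤ RCLike.re ⟪resolventSq D x, x⟫_ℂ
    rw [inner_resolventSq]
    exact Submodule.re_inner_starProjection_nonneg _ _

theorem resolventSq_le_one : 0 ≤ 1 - resolventSq D := by
  rw [ContinuousLinearMap.nonneg_iff_isPositive, ContinuousLinearMap.isPositive_def]
  have hs := (ContinuousLinearMap.nonneg_iff_isPositive _).mp (resolventSq_nonneg (D := D))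
  constructor
  · intro x y
    have := hs.isSymmetric x y
    change ⟪x - resolventSq D x, y⟫_ℂ = ⟪x, y - resolventSq D y⟫_ℂ
    rw [inner_sub_left, inner_sub_right]
    exact congrArg _ this
  · intro x
    change 0 ≤ RCLike.re ⟪x - resolventSq D x, x⟫_ℂ
    rw [inner_sub_left, map_sub, sub_nonneg, inner_resolventSq,
      Submodule.re_inner_starProjection_eq_normSq, inner_self_eq_norm_sq]
    have h := (closedGraph D).norm_starProjection_apply_le (WithLp.toLp 2 (x, 0))
    rw [WithLp.norm_toLp_fst] at h
    exact pow_le_pow_left₀ (norm_nonneg _) h 2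


theorem commute_sqrt :
    Commute (CFC.sqrt (resolventSq D)) (CFC.sqrt (1 - resolventSq D)) := by
  have h0 : Commute (resolventSq D) (1 - resolventSq D) :=
    (Commute.one_right _).sub_right (Commute.refl _)
  have h1 : Commute (CFC.sqrt (resolventSq D)) (1 - resolventSq D) := h0.cfcₙ_nnreal _
  exact (h1.symm.cfcₙ_nnreal _).symm

theorem sqrt_inner_symm (T : H →L[ℂ] H) (x y : H) :
    ⟪CFC.sqrt T x, y⟫_ℂ = ⟪x, CFC.sqrt T y⟫_ℂ :=
  ((ContinuousLinearMap.nonneg_iff_isPositive _).mp (CFC.sqrt_nonneg T)).isSymmetric x y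

theorem sqrt_sqrt_apply {T : H →L[ℂ] H} (hT : 0 ≤ T) (x : H) :
    CFC.sqrt T (CFC.sqrt T x) = T x :=
  congrArg (fun U : H →L[ℂ] H => U x) (CFC.sqrt_mul_sqrt_self T hT)

theorem sqrt_comm_apply (x : H) :
    CFC.sqrt (resolventSq D) (CFC.sqrt (1 - resolventSq D) x) =
      CFC.sqrt (1 - resolventSq D) (CFC.sqrt (resolventSq D) x) :=
  congrArg (fun U : H →L[ℂ] H => U x) (commute_sqrt (D := D)).eq

theorem sqrt_resolventSq_injective (hD : IsSelfAdjoint D) {x : H}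
    (hx : CFC.sqrt (resolventSq D) x = 0) : x = 0 := by
  have h1 : resolventSq D x = 0 := by
    rw [← sqrt_sqrt_apply resolventSq_nonneg, hx, map_zero]
  obtain ⟨y, h2, h3⟩ := resolventSq_spec hD x
  rw [h1] at h2 h3
  have h4 : y = 0 := LinearPMap.graph_fst_eq_zero_snd D h2 rfl
  rw [sub_zero] at h3
  exact LinearPMap.graph_fst_eq_zero_snd D h3 h4

theorem mem_graph_modulus (hD : IsSelfAdjoint D) {u v : H} :
    (u, v) ∈ (modulus D).graph ↔
      ∃ x, CFC.sqrt (resolventSq D) x = u ∧ CFC.sqrt (1 - resolventSq D) x = v := by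
  unfold modulus
  rw [Submodule.toLinearPMap_graph_eq]
  · constructor
    · rintro ⟨x, hx⟩
      exact ⟨x, congrArg Prod.fst hx, congrArg Prod.snd hx⟩
    · rintro ⟨x, rfl, rfl⟩
      exact ⟨x, rfl⟩
  · rintro _ ⟨x, rfl⟩ hx
    have hx' : CFC.sqrt (resolventSq D) x = 0 := hx
    change CFC.sqrt (1 - resolventSq D) x = 0
    rw [sqrt_resolventSq_injective hD hx', map_zero]

theorem mem_graph_modulus' {u v : H}
    (h : CFC.sqrt (resolventSq D) v = CFC.sqrt (1 - resolventSq D) u) :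
    CFC.sqrt (resolventSq D) (CFC.sqrt (resolventSq D) u + CFC.sqrt (1 - resolventSq D) v) = u ∧
    CFC.sqrt (1 - resolventSq D)
      (CFC.sqrt (resolventSq D) u + CFC.sqrt (1 - resolventSq D) v) = v := by
  constructor
  · rw [map_add, sqrt_comm_apply, h, sqrt_sqrt_apply resolventSq_nonneg,
      sqrt_sqrt_apply resolventSq_le_one]
    simp
  · rw [map_add, ← sqrt_comm_apply, ← h, sqrt_sqrt_apply resolventSq_nonneg,
      sqrt_sqrt_apply resolventSq_le_one]
    simp

theorem dense_domain_modulus (hD : IsSelfAdjoint D) : Dense ((modulus D).domain : Set H) := by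
  rw [Submodule.dense_iff_topologicalClosure_eq_top,
    Submodule.topologicalClosure_eq_top_iff, Submodule.eq_bot_iff]
  intro z hz
  apply sqrt_resolventSq_injective hD
  refine ext_inner_left ℂ fun x => ?_
  rw [inner_zero_right, ← sqrt_inner_symm]
  have : (CFC.sqrt (resolventSq D) x, CFC.sqrt (1 - resolventSq D) x) ∈ (modulus D).graph :=
    (mem_graph_modulus hD).mpr ⟨x, rfl, rfl⟩
  exact (Submodule.mem_orthogonal _ _).mp hz _ (LinearPMap.mem_domain_of_mem_graph this)

/-- For `D` self-adjoint, `|D|` is self-adjoint, positive, and `|D|² = D²` (with equality of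
domains; both squares are described through their graphs). -/
theorem modulus_spec (hD : IsSelfAdjoint D) :
    IsSelfAdjoint (modulus D) ∧
    (∀ x : (modulus D).domain, 0 ≤ RCLike.re ⟪(x : H), modulus D x⟫_ℂ) ∧
    (∀ u w : H, (∃ v, (u, v) ∈ (modulus D).graph ∧ (v, w) ∈ (modulus D).graph) ↔
      ∃ v, (u, v) ∈ D.graph ∧ (v, w) ∈ D.graph) := by
  refine ⟨?_, ?_, ?_⟩
  · rw [LinearPMap.isSelfAdjoint_def]
    apply LinearPMap.eq_of_eq_graph
    rw [LinearPMap.adjoint_graph_eq_graph_adjoint (dense_domain_modulus hD)]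
    ext ⟨u, v⟩
    rw [Submodule.mem_adjoint_iff, mem_graph_modulus hD]
    constructor
    · intro h
      refine ⟨_, mem_graph_modulus' ?_⟩
      refine ext_inner_left ℂ fun y => ?_
      have := h _ _ ((mem_graph_modulus hD).mpr ⟨y, rfl, rfl⟩)
      rw [← sqrt_inner_symm, ← sqrt_inner_symm]
      exact (sub_eq_zero.mp this).symm
    · rintro ⟨x, rfl, rfl⟩ a b hab
      obtain ⟨y, rfl, rfl⟩ := (mem_graph_modulus hD).mp hab
      rw [sub_eq_zero, sqrt_inner_symm, sqrt_inner_symm, sqrt_comm_apply]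
  · intro x
    obtain ⟨y, h1, h2⟩ := (mem_graph_modulus hD).mp (LinearPMap.mem_graph _ x)
    rw [← h1, ← h2, sqrt_inner_symm]
    have h3 : 0 ≤ CFC.sqrt (resolventSq D) * CFC.sqrt (1 - resolventSq D) :=
      commute_sqrt.mul_nonneg (CFC.sqrt_nonneg _) (CFC.sqrt_nonneg _)
    exact ((ContinuousLinearMap.nonneg_iff_isPositive _).mp h3).re_inner_nonneg_right y
  · intro u w
    have key : (∃ v, (u, v) ∈ (modulus D).graph ∧ (v, w) ∈ (modulus D).graph) ↔
        resolventSq D (u + w) = u := by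
      constructor
      · rintro ⟨v, h1, h2⟩
        obtain ⟨x, rfl, h3⟩ := (mem_graph_modulus hD).mp h1
        obtain ⟨y, h4, rfl⟩ := (mem_graph_modulus hD).mp h2
        have h5 : CFC.sqrt (1 - resolventSq D) x = CFC.sqrt (resolventSq D) y := by rw [h3, h4]
        rw [← sqrt_sqrt_apply resolventSq_nonneg, map_add,
          sqrt_comm_apply, ← h5, sqrt_sqrt_apply resolventSq_nonneg,
          sqrt_sqrt_apply resolventSq_le_one]
        simp
      · intro h
        refine ⟨CFC.sqrt (1 - resolventSq D) (CFC.sqrt (resolventSq D) (u + w)),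
          (mem_graph_modulus hD).mpr ⟨CFC.sqrt (resolventSq D) (u + w), ?_, rfl⟩,
          (mem_graph_modulus hD).mpr ⟨CFC.sqrt (1 - resolventSq D) (u + w), ?_, ?_⟩⟩
        · rw [sqrt_sqrt_apply resolventSq_nonneg, h]
        · rw [sqrt_comm_apply]
        · rw [sqrt_sqrt_apply resolventSq_le_one]
          change u + w - resolventSq D (u + w) = w
          rw [h]
          abel
    rw [key]
    constructor
    · intro h
      obtain ⟨y, h1, h2⟩ := resolventSq_spec hD (u + w)
      rw [h] at h1 h2
      rw [add_sub_cancel_left] at h2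
      exact ⟨y, h1, h2⟩
    · rintro ⟨v, h1, h2⟩
      exact resolventSq_unique hD h1 h2

end ModulusSpec

/-! ### Commutators, smooth vectors and spectral triples -/

/-- `T` maps the domain of `P` to itself and `[P, T]`, defined on the domain of `P`, extends to
the bounded operator `S`. -/
def HasBoundedCommutator (P : H →ₗ.[ℂ] H) (T S : H →L[ℂ] H) : Prop :=
  ∀ ξ : P.domain, ∃ h : T ξ ∈ P.domain, P ⟨T ξ, h⟩ - T (P ξ) = S ξ

/-- `D` has compact resolvent: for some `z` in its resolvent set, `(D - z)⁻¹` is compact. -/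
def HasCompactResolvent (D : H →ₗ.[ℂ] H) : Prop :=
  ∃ (z : ℂ) (R : H →L[ℂ] H), IsCompactOperator R ∧
    (∀ η : H, ∃ h : R η ∈ D.domain, D ⟨R η, h⟩ - z • R η = η) ∧
    (∀ ξ : D.domain, R (D ξ - z • (ξ : H)) = ξ)

/-- A spectral triple `(A, H, D)`: a unital (real or complex) `*`-algebra `A` of bounded operators
on the complex Hilbert space `H` and a self-adjoint operator `D` with compact resolvent whose
commutators with the elements of `A` are bounded. -/
structure IsSpectralTriple (A : StarSubalgebra ℝ (H →L[ℂ] H)) (D : H →ₗ.[ℂ] H) : Prop where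
  isSelfAdjoint : IsSelfAdjoint D
  hasCompactResolvent : HasCompactResolvent D
  bounded_commutator : ∀ a ∈ A, ∃ S : H →L[ℂ] H, HasBoundedCommutator D a S

/-- The domain of `D ^ k`. -/
def domPow (D : H →ₗ.[ℂ] H) : ℕ → Submodule ℂ H
  | 0 => ⊤
  | k + 1 => ((domPow D k).comap D.toFun).map D.domain.subtype

/-- `H^∞ = ⋂ₖ dom D ^ k`. -/
def smooth (D : H →ₗ.[ℂ] H) : Submodule ℂ H := ⨅ k, domPow D k

theorem smooth_le_domain (D : H →ₗ.[ℂ] H) : smooth D ≤ D.domain := by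
  intro ξ hξ
  obtain ⟨y, -, rfl⟩ := (Submodule.mem_iInf _).mp hξ 1
  exact y.2

theorem apply_mem_smooth (D : H →ₗ.[ℂ] H) (ξ : smooth D) :
    D ⟨ξ, smooth_le_domain D ξ.2⟩ ∈ smooth D := by
  refine (Submodule.mem_iInf _).mpr fun k => ?_
  obtain ⟨y, hy, h⟩ := (Submodule.mem_iInf _).mp ξ.2 (k + 1)
  have : (⟨ξ, smooth_le_domain D ξ.2⟩ : D.domain) = y := Subtype.ext h.symm
  rw [this]
  exact hy

/-- `D` as a linear operator on `H^∞`. -/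
def smoothOp (D : H →ₗ.[ℂ] H) : Module.End ℂ (smooth D) where
  toFun ξ := ⟨D ⟨ξ, smooth_le_domain D ξ.2⟩, apply_mem_smooth D ξ⟩
  map_add' ξ η := Subtype.ext
    (D.map_add ⟨ξ, smooth_le_domain D ξ.2⟩ ⟨η, smooth_le_domain D η.2⟩)
  map_smul' c ξ := Subtype.ext (D.map_smul c ⟨ξ, smooth_le_domain D ξ.2⟩)

/-- The operator `X` on `H^∞` is the restriction of the bounded operator `T`. -/
def IsRestriction {D : H →ₗ.[ℂ] H} (X : Module.End ℂ (smooth D)) (T : H →L[ℂ] H) : Prop :=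
  ∀ ξ : smooth D, (X ξ : H) = T ξ

/-- The (restrictions to `H^∞` of the) elements of `A`, as linear operators on `H^∞`. -/
def algOps (A : StarSubalgebra ℝ (H →L[ℂ] H)) (D : H →ₗ.[ℂ] H) :
    Set (Module.End ℂ (smooth D)) :=
  {X | ∃ a ∈ A, IsRestriction X a}

/-- `End_A(H^∞)`: the linear operators on `H^∞` that commute with every element of `A`. -/
def endoOps (A : StarSubalgebra ℝ (H →L[ℂ] H)) (D : H →ₗ.[ℂ] H) :
    Set (Module.End ℂ (smooth D)) :=
  {X | ∀ a ∈ A, ∀ ξ η : smooth D, (η : H) = a ξ → (X η : H) = a (X ξ)}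

/-! ### Regularity -/

/-- `T` lies in the domain of `δ ^ n`, where `δ T = [|D|, T]`: its domain consists of the bounded
operators that preserve `dom |D|` and have bounded commutator with `|D|`. -/
def MemDomDelta (D : H →ₗ.[ℂ] H) : ℕ → (H →L[ℂ] H) → Prop
  | 0, _ => True
  | n + 1, T => ∃ S : H →L[ℂ] H, HasBoundedCommutator (modulus D) T S ∧ MemDomDelta D n S

/-- A regular spectral triple: `A + [D, A] ⊆ ⋂ₖ dom δ ^ k`. -/
structure IsRegular (A : StarSubalgebra ℝ (H →L[ℂ] H)) (D : H →ₗ.[ℂ] H) : Prop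
    extends IsSpectralTriple A D where
  alg_smooth : ∀ a ∈ A, ∀ n, MemDomDelta D n a
  commutator_smooth : ∀ a ∈ A, ∀ S : H →L[ℂ] H, HasBoundedCommutator D a S →
    ∀ n, MemDomDelta D n S

/-- A strongly regular spectral triple: in addition `End_A(H^∞) ⊆ ⋂ₖ dom δ ^ k`; that is, every
`A`-linear operator on `H^∞` extends to a bounded operator lying in every `dom δ ^ k`. -/
structure IsStronglyRegular (A : StarSubalgebra ℝ (H →L[ℂ] H)) (D : H →ₗ.[ℂ] H) : Prop
    extends IsRegular A D where
  endo_smooth : ∀ X ∈ endoOps A D, ∃ T : H →L[ℂ] H, IsRestriction X T ∧ ∀ n, MemDomDelta D n T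

/-! ### The (extended) algebra of differential operators -/

/-- The generators `A` and `[D, A]`, as linear operators on `H^∞`. -/
def diffGens (A : StarSubalgebra ℝ (H →L[ℂ] H)) (D : H →ₗ.[ℂ] H) :
    Set (Module.End ℂ (smooth D)) :=
  algOps A D ∪ (fun X => smoothOp D * X - X * smoothOp D) '' algOps A D

/-- `𝒟₀` for the algebra of differential operators: the algebra generated by `A` and `[D, A]`. -/
def diffZero (A : StarSubalgebra ℝ (H →L[ℂ] H)) (D : H →ₗ.[ℂ] H) :
    Subalgebra ℂ (Module.End ℂ (smooth D)) :=
  Algebra.adjoin ℂ (diffGens A D)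

/-- `𝒟₀` for the extended algebra of differential operators: the algebra generated by `A`,
`[D, A]` and `End_A(H^∞)`. -/
def extDiffZero (A : StarSubalgebra ℝ (H →L[ℂ] H)) (D : H →ₗ.[ℂ] H) :
    Subalgebra ℂ (Module.End ℂ (smooth D)) :=
  Algebra.adjoin ℂ (diffGens A D ∪ endoOps A D)

/-- The commutator `X ↦ [Y, X]` as a linear map. -/
def commMap {D : H →ₗ.[ℂ] H} (Y : Module.End ℂ (smooth D)) :
    Module.End ℂ (smooth D) →ₗ[ℂ] Module.End ℂ (smooth D) :=
  LinearMap.mulLeft ℂ Y - LinearMap.mulRight ℂ Y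

/-- The `k`-th inductive piece built on `𝒟₀`:
`𝒟ₖ = ∑_{0 < j < k} 𝒟ⱼ 𝒟ₖ₋ⱼ + [D², 𝒟ₖ₋₁] + 𝒟₀ [D², 𝒟ₖ₋₁]` for `k ≥ 1`
(the sum over `j` is empty for `k = 1`). -/
def diffPiece (D : H →ₗ.[ℂ] H) (D₀ : Subalgebra ℂ (Module.End ℂ (smooth D))) :
    ℕ → Submodule ℂ (Module.End ℂ (smooth D))
  | 0 => Subalgebra.toSubmodule D₀
  | k + 1 =>
    (⨆ j : Fin k, diffPiece D D₀ (j + 1) * diffPiece D D₀ (k - j)) ⊔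
      (diffPiece D D₀ k).map (commMap (smoothOp D ^ 2)) ⊔
      Subalgebra.toSubmodule D₀ * (diffPiece D D₀ k).map (commMap (smoothOp D ^ 2))
  decreasing_by all_goals omega

/-- The operators of order `≤ k`: the increasing filtration determined by the pieces. -/
def diffOrder (D : H →ₗ.[ℂ] H) (D₀ : Subalgebra ℂ (Module.End ℂ (smooth D))) (k : ℕ) :
    Submodule ℂ (Module.End ℂ (smooth D)) :=
  ⨆ j : Fin (k + 1), diffPiece D D₀ j

/-! ### Perturbation -/

/-- The perturbed operator `D + M`, with the same domain as `D`. -/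
def perturb (D : H →ₗ.[ℂ] H) (M : H →L[ℂ] H) : H →ₗ.[ℂ] H := M.toLinearMap +ᵥ D

end NCG

end

/-! Write E = D + M, Q = (1 + E²)^{1/2}, and let T be of order zero. Regularity puts the order-zero
algebra inside B = ⋂ dom δⁿ, which is stable under [|D|, ·]. As [|D|², X] = |D|[|D|, X] + [|D|,
X]|D|, an operator of order k is a combination of X|D|ʲ with X ∈ B and j ≤ k. This gives the
elliptic estimate ‖Yξ‖ ≤ C ∑_{j ≤ k} ‖Dʲξ‖ (`exists_norm_apply_le`), and powers of D may be replaced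
there by powers of E because M has order zero (`exists_norm_pow_le`).

The hypothesis on E² − D² says that [E², ·], like [D², ·], raises the order by at most one. Hence
the n-th iterated commutator of E² with T has order at most n, and multiplied on the right by Q⁻ⁿ it
is bounded. It remains to pass from commutators with Q² to commutators with Q, and then to |E|.

E again has compact resolvent, so this can be done on matrices in an eigenbasis of E². If qᵢ are the
eigenvalues of Q and tᵢⱼ the entries of T, the matrices ((qᵢ² − qⱼ²)/qⱼ)ⁿ tᵢⱼ are bounded, and (qᵢ −
qⱼ)ⁿ tᵢⱼ must be shown bounded. The quotient of the weights, qⱼ/(qᵢ + qⱼ), need not be a bounded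
Schur multiplier, but it equals 1/2 − 1/2 · [qⱼ/(qᵢ + qⱼ)²] · [(qᵢ² − qⱼ²)/qⱼ]. The first bracket is
a bounded multiplier, by the operator arithmetic-geometric mean inequality; the second is one more
commutator with Q², which is available since n is arbitrary (`isBoundedMatrix_commutator_of_sq`).
Finally Q − |E| is bounded and diagonal, so Q may be replaced by |E|
(`isBoundedMatrix_commutator_of_sub_bounded`). Bounded matrices come from bounded operators, which
yields T ∈ dom δⁿ for the modulus of E (`memDomDelta_perturb`).

For strong regularity, M preserves every dom Dᵏ, so H^∞ is unchanged; hence so is End_A(H^∞), which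
is part of the extended order-zero algebra. -/

noncomputable section

namespace NCG

/-! ### Bounded infinite matrices -/

open Filter Topology

/-! ### The arithmetic-geometric mean inequality in finite dimension -/

section FiniteDimensional

variable {V : Type*} [NormedAddCommGroup V] [InnerProductSpace ℂ V] [FiniteDimensional ℂ V]

/-- A linear map of a finite-dimensional Hilbert space attains its norm at a singular vector. -/
theorem exists_singular_vector [Nontrivial V] (Z : V →ₗ[ℂ] V) :
    ∃ v : V, ‖v‖ = 1 ∧ (∀ w, ‖Z w‖ ≤ ‖Z v‖ * ‖w‖) ∧
      ∀ w, ⟪Z v, Z w⟫_ℂ = (‖Z v‖ : ℂ) ^ 2 * ⟪v, w⟫_ℂ := by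
  obtain ⟨v, hv, hmax⟩ := (isCompact_sphere (0 : V) 1).exists_isMaxOn
    (NormedSpace.sphere_nonempty.mpr zero_le_one)
    (LinearMap.continuous_of_finiteDimensional Z).norm.continuousOn
  have hv1 : ‖v‖ = 1 := by simpa using hv
  have hle : ∀ w, ‖Z w‖ ≤ ‖Z v‖ * ‖w‖ := by
    intro w
    rcases eq_or_ne w 0 with rfl | hw
    · simp
    have hw' : 0 < ‖w‖ := norm_pos_iff.mpr hw
    have h1 : ((‖w‖⁻¹ : ℝ) : ℂ) • w ∈ Metric.sphere (0 : V) 1 := by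
      simp [norm_smul, hw'.ne']
    have h2 : ‖Z (((‖w‖⁻¹ : ℝ) : ℂ) • w)‖ ≤ ‖Z v‖ := hmax h1
    rw [map_smul, norm_smul] at h2
    simp only [Complex.ofReal_inv, norm_inv, Complex.norm_real, norm_norm] at h2
    rwa [inv_mul_le_iff₀ hw', mul_comm] at h2
  refine ⟨v, hv1, hle, ?_⟩
  set s := ‖Z v‖
  -- The last claim amounts to Z*Zv = s²v. It follows from ‖Z*Zv‖ ≤ s², since ‖d‖² = ‖Z*Zv‖² − 2s⁴ +
  -- s⁴ ≤ 0.
  set d := Z.adjoint (Z v) - (s : ℂ) ^ 2 • v with hd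
  have hadj : ‖Z.adjoint (Z v)‖ ≤ s * s := by
    rcases eq_or_ne (Z.adjoint (Z v)) 0 with h0 | h0
    · rw [h0, norm_zero]; positivity
    have h3 : ‖Z.adjoint (Z v)‖ ^ 2 ≤ s * (s * ‖Z.adjoint (Z v)‖) := by
      rw [← inner_self_eq_norm_sq (𝕜 := ℂ), LinearMap.adjoint_inner_left]
      refine (RCLike.re_le_norm _).trans ((norm_inner_le_norm _ _).trans ?_)
      exact mul_le_mul_of_nonneg_left (hle _) (norm_nonneg _)
    have h4 : 0 < ‖Z.adjoint (Z v)‖ := norm_pos_iff.mpr h0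
    nlinarith
  have hd0 : d = 0 := by
    have h5 : ‖d‖ ^ 2 ≤ 0 := by
      rw [hd, norm_sub_sq (𝕜 := ℂ), inner_smul_right, LinearMap.adjoint_inner_left,
        inner_self_eq_norm_sq_to_K, norm_smul, hv1]
      have h6 : RCLike.re ((s : ℂ) ^ 2 * ((‖Z v‖ : ℝ) : ℂ) ^ 2) = s ^ 4 := by
        have : (s : ℂ) ^ 2 * ((‖Z v‖ : ℝ) : ℂ) ^ 2 = ((s ^ 4 : ℝ) : ℂ) := by
          push_cast; ring
        rw [this]; exact Complex.ofReal_re _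
      have h7 : ‖(s : ℂ) ^ 2‖ = s ^ 2 := by
        rw [norm_pow, Complex.norm_real, Real.norm_of_nonneg (norm_nonneg _)]
      have h8 := pow_le_pow_left₀ (norm_nonneg _) hadj 2
      erw [h6]
      rw [h7]
      nlinarith
    have h9 : ‖d‖ = 0 := by nlinarith [norm_nonneg d]
    exact norm_eq_zero.mp h9
  intro w
  rw [← LinearMap.adjoint_inner_left, sub_eq_zero.mp hd0, inner_smul_left]
  simp

/-- The arithmetic-geometric mean inequality for operators: if `A Y A = A² Z + Z A²`, then
`‖Z‖ ≤ ‖Y‖ / 2`. -/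
theorem norm_le_of_arith_geom_mean {A Y Z : V →ₗ[ℂ] V} {C : ℝ}
    (hA : A.IsSymmetric) (hinj : ∀ v, A v = 0 → v = 0)
    (h : ∀ u v, ⟪A u, Y (A v)⟫_ℂ = ⟪A (A u), Z v⟫_ℂ + ⟪u, Z (A (A v))⟫_ℂ)
    (hY : ∀ u v, ‖⟪u, Y v⟫_ℂ‖ ≤ C * ‖u‖ * ‖v‖) (v : V) : ‖Z v‖ ≤ C / 2 * ‖v‖ := by
  rcases eq_or_ne v 0 with rfl | hv
  · simp
  have : Nontrivial V := ⟨v, 0, hv⟩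
  have hC : 0 ≤ C := by
    have h1 := (norm_nonneg _).trans (hY v v)
    have h2 : 0 < ‖v‖ := norm_pos_iff.mpr hv
    by_contra! h3
    have : C * ‖v‖ * ‖v‖ < 0 := mul_neg_of_neg_of_pos (mul_neg_of_neg_of_pos h3 h2) h2
    linarith
  obtain ⟨w, hw, hle, hs⟩ := exists_singular_vector Z
  refine (hle v).trans (mul_le_mul_of_nonneg_right ?_ (norm_nonneg _))
  rcases eq_or_ne (Z w) 0 with h0 | h0
  · rw [h0, norm_zero]; positivity
  have hp : 0 < ‖A (Z w)‖ := norm_pos_iff.mpr fun h1 => h0 (hinj _ h1)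
  have hq : 0 < ‖A w‖ := norm_pos_iff.mpr fun h1 => by
    rw [hinj _ h1] at hw; simp at hw
  -- Test the identity on u = Zw, v = w: the singular vector relation turns the right side into a
  -- sum of two squares, which is at least twice the product ‖AZw‖ · ‖Zw‖ ‖Aw‖.
  have key : ⟪A (Z w), Y (A w)⟫_ℂ = ((‖A (Z w)‖ ^ 2 + ‖Z w‖ ^ 2 * ‖A w‖ ^ 2 : ℝ) : ℂ) := by
    rw [h, hs, hA, ← hA w, inner_self_eq_norm_sq_to_K, inner_self_eq_norm_sq_to_K]
    push_cast
    rfl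
  have h2 := hY (A (Z w)) (A w)
  rw [key, Complex.norm_real, Real.norm_of_nonneg (by positivity)] at h2
  have h3 : 2 * ‖Z w‖ * (‖A (Z w)‖ * ‖A w‖) ≤ C * (‖A (Z w)‖ * ‖A w‖) := by
    nlinarith [sq_nonneg (‖A (Z w)‖ - ‖Z w‖ * ‖A w‖)]
  have h4 := le_of_mul_le_mul_right h3 (mul_pos hp hq)
  linarith

end FiniteDimensional

/-! ### Bounded matrices, Schur multipliers and the operators they define -/

section BoundedMatrix

variable {ι : Type*}

/-- The infinite matrix `t` is bounded, uniformly on its finite truncations. -/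
def IsBoundedMatrix (t : ι → ι → ℂ) : Prop :=
  ∃ C : ℝ, ∀ (F : Finset ι) (x y : ι → ℂ),
    ‖∑ i ∈ F, ∑ j ∈ F, starRingEnd ℂ (x i) * t i j * y j‖ ≤
      C * √(∑ i ∈ F, ‖x i‖ ^ 2) * √(∑ j ∈ F, ‖y j‖ ^ 2)

namespace IsBoundedMatrix

variable {s t : ι → ι → ℂ}

theorem add (hs : IsBoundedMatrix s) (ht : IsBoundedMatrix t) :
    IsBoundedMatrix fun i j => s i j + t i j := by
  obtain ⟨C, hC⟩ := hs
  obtain ⟨C', hC'⟩ := ht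
  refine ⟨C + C', fun F x y => ?_⟩
  have : ∑ i ∈ F, ∑ j ∈ F, starRingEnd ℂ (x i) * (s i j + t i j) * y j =
      ∑ i ∈ F, ∑ j ∈ F, starRingEnd ℂ (x i) * s i j * y j +
      ∑ i ∈ F, ∑ j ∈ F, starRingEnd ℂ (x i) * t i j * y j := by
    simp only [mul_add, add_mul, Finset.sum_add_distrib]
  rw [this, add_mul, add_mul]
  exact (norm_add_le _ _).trans (add_le_add (hC F x y) (hC' F x y))

theorem sqrt_sum_mul_le {a : ι → ℂ} {b : ℝ} (hb : 0 ≤ b) (ha : ∀ i, ‖a i‖ ≤ b) (F : Finset ι)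
    (x : ι → ℂ) : √(∑ i ∈ F, ‖a i * x i‖ ^ 2) ≤ b * √(∑ i ∈ F, ‖x i‖ ^ 2) := by
  rw [← Real.sqrt_sq hb, ← Real.sqrt_mul (sq_nonneg b), Finset.mul_sum]
  refine Real.sqrt_le_sqrt (Finset.sum_le_sum fun i _ => ?_)
  rw [norm_mul, mul_pow]
  exact mul_le_mul_of_nonneg_right (pow_le_pow_left₀ (norm_nonneg _) (ha i) 2) (sq_nonneg _)

theorem exists_nonneg (ht : IsBoundedMatrix t) :
    ∃ C : ℝ, 0 ≤ C ∧ ∀ (F : Finset ι) (x y : ι → ℂ),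
      ‖∑ i ∈ F, ∑ j ∈ F, starRingEnd ℂ (x i) * t i j * y j‖ ≤
        C * √(∑ i ∈ F, ‖x i‖ ^ 2) * √(∑ j ∈ F, ‖y j‖ ^ 2) := by
  obtain ⟨C, hC⟩ := ht
  refine ⟨|C|, abs_nonneg C, fun F x y => (hC F x y).trans ?_⟩
  gcongr
  exact le_abs_self C

theorem left_mul (ht : IsBoundedMatrix t) {a : ι → ℂ} {b : ℝ} (ha : ∀ i, ‖a i‖ ≤ b) :
    IsBoundedMatrix fun i j => a i * t i j := by
  obtain ⟨C, hC0, hC⟩ := ht.exists_nonneg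
  refine ⟨C * |b|, fun F x y => ?_⟩
  have h1 := hC F (fun i => starRingEnd ℂ (a i) * x i) y
  have h2 := sqrt_sum_mul_le (a := fun i => starRingEnd ℂ (a i)) (abs_nonneg b)
    (fun i => by simpa using (ha i).trans (le_abs_self b)) F x
  have : ∑ i ∈ F, ∑ j ∈ F, starRingEnd ℂ (x i) * (a i * t i j) * y j =
      ∑ i ∈ F, ∑ j ∈ F, starRingEnd ℂ (starRingEnd ℂ (a i) * x i) * t i j * y j := by
    refine Finset.sum_congr rfl fun i _ => Finset.sum_congr rfl fun j _ => ?_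
    simp only [map_mul, Complex.conj_conj]; ring
  rw [this]
  refine h1.trans (mul_le_mul_of_nonneg_right ?_ (Real.sqrt_nonneg _))
  rw [mul_assoc]
  exact mul_le_mul_of_nonneg_left h2 hC0

theorem right_mul (ht : IsBoundedMatrix t) {a : ι → ℂ} {b : ℝ} (ha : ∀ i, ‖a i‖ ≤ b) :
    IsBoundedMatrix fun i j => a j * t i j := by
  obtain ⟨C, hC0, hC⟩ := ht.exists_nonneg
  refine ⟨C * |b|, fun F x y => ?_⟩
  have h1 := hC F x (fun i => a i * y i)
  have h2 := sqrt_sum_mul_le (abs_nonneg b) (fun i => (ha i).trans (le_abs_self b)) F y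
  have : ∑ i ∈ F, ∑ j ∈ F, starRingEnd ℂ (x i) * (a j * t i j) * y j =
      ∑ i ∈ F, ∑ j ∈ F, starRingEnd ℂ (x i) * t i j * (a j * y j) := by
    refine Finset.sum_congr rfl fun i _ => Finset.sum_congr rfl fun j _ => ?_
    ring
  rw [this]
  refine h1.trans ((mul_le_mul_of_nonneg_left h2 (by positivity)).trans_eq ?_)
  ring

theorem const_mul (ht : IsBoundedMatrix t) (c : ℂ) : IsBoundedMatrix fun i j => c * t i j :=
  ht.left_mul (a := fun _ => c) (b := ‖c‖) fun _ => le_rfl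

theorem sub (hs : IsBoundedMatrix s) (ht : IsBoundedMatrix t) :
    IsBoundedMatrix fun i j => s i j - t i j := by
  have := hs.add (ht.const_mul (-1))
  simpa [sub_eq_add_neg] using this

open Classical in
/-- The operator with matrix `t` on the finite-dimensional space spanned by `F`. -/
def truncation (t : ι → ι → ℂ) (F : Finset ι) : EuclideanSpace ℂ F →ₗ[ℂ] EuclideanSpace ℂ F :=
  Matrix.toEuclideanLin (Matrix.of fun i j : F => t i j)

theorem inner_truncation (t : ι → ι → ℂ) (F : Finset ι) (x y : EuclideanSpace ℂ F) :
    ⟪x, truncation t F y⟫_ℂ = ∑ i : F, ∑ j : F, starRingEnd ℂ (x i) * t i j * y j := by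
  rw [PiLp.inner_apply]
  refine Finset.sum_congr rfl fun i _ => ?_
  simp only [truncation, Matrix.toLpLin_apply, Matrix.mulVec, dotProduct, Matrix.of_apply,
    RCLike.inner_apply, Finset.sum_mul]
  refine Finset.sum_congr rfl fun j _ => ?_
  ring

open Classical in
/-- Extension by zero of a vector on `F`. -/
def extendZero (F : Finset ι) (x : EuclideanSpace ℂ F) (i : ι) : ℂ :=
  if h : i ∈ F then x ⟨i, h⟩ else 0

theorem extendZero_coe (F : Finset ι) (x : EuclideanSpace ℂ F) (i : F) :
    extendZero F x i = x i := by
  simp [extendZero]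

theorem iff_truncation :
    IsBoundedMatrix t ↔ ∃ C : ℝ, ∀ (F : Finset ι) (x y : EuclideanSpace ℂ F),
      ‖⟪x, truncation t F y⟫_ℂ‖ ≤ C * ‖x‖ * ‖y‖ := by
  constructor
  · rintro ⟨C, hC⟩
    refine ⟨C, fun F x y => ?_⟩
    have := hC F (extendZero F x) (extendZero F y)
    rw [inner_truncation, EuclideanSpace.norm_eq, EuclideanSpace.norm_eq]
    simp_rw [← Finset.sum_coe_sort F, extendZero_coe] at this
    exact this
  · rintro ⟨C, hC⟩
    refine ⟨C, fun F x y => ?_⟩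
    have := hC F (WithLp.toLp 2 fun i : F => x i) (WithLp.toLp 2 fun i : F => y i)
    rw [inner_truncation, EuclideanSpace.norm_eq, EuclideanSpace.norm_eq] at this
    simp_rw [← Finset.sum_coe_sort F]
    exact this

/-- The Hadamard product with `√(qᵢ qⱼ) / (qᵢ + qⱼ)` preserves bounded matrices. -/
theorem hadamard_mean (ht : IsBoundedMatrix t) {a : ι → ℝ} (ha : ∀ i, 0 < a i) :
    IsBoundedMatrix fun i j => ((a i * a j / (a i ^ 2 + a j ^ 2) : ℝ) : ℂ) * t i j := by
  classical
  rw [iff_truncation] at ht ⊢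
  obtain ⟨C, hC⟩ := ht
  refine ⟨C / 2, fun F x y => ?_⟩
  -- With A diagonal with entries aᵢ, the new matrix Z solves A Y A = A² Z + Z A²: entrywise, aᵢ aⱼ
  -- tᵢⱼ = (aᵢ² + aⱼ²) zᵢⱼ. The bound C / 2 does not depend on F.
  set A : EuclideanSpace ℂ F →ₗ[ℂ] EuclideanSpace ℂ F :=
    Matrix.toEuclideanLin (Matrix.diagonal fun i : F => ((a i : ℝ) : ℂ)) with hA
  have hA' : ∀ (u : EuclideanSpace ℂ F) (i : F), A u i = (a i : ℂ) * u i := by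
    intro u i
    simp [hA, Matrix.toLpLin_apply, Matrix.mulVec_diagonal]
  have hsymm : A.IsSymmetric := by
    intro u v
    rw [PiLp.inner_apply, PiLp.inner_apply]
    refine Finset.sum_congr rfl fun i _ => ?_
    simp only [hA', RCLike.inner_apply, map_mul, Complex.conj_ofReal]
    ring
  have hinj : ∀ v, A v = 0 → v = 0 := by
    intro v hv
    ext i
    have h1 : A v i = 0 := by rw [hv]; rfl
    rw [hA'] at h1
    rcases mul_eq_zero.mp h1 with h2 | h2
    · exact absurd (Complex.ofReal_eq_zero.mp h2) (ha i).ne'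
    · exact h2
  have h := norm_le_of_arith_geom_mean (A := A) (Y := truncation t F)
    (Z := truncation (fun i j => ((a i * a j / (a i ^ 2 + a j ^ 2) : ℝ) : ℂ) * t i j) F) (C := C)
    hsymm hinj ?_ (hC F) y
  · refine (norm_inner_le_norm _ _).trans ((mul_le_mul_of_nonneg_left h (norm_nonneg _)).trans_eq ?_)
    ring
  · intro u v
    simp only [inner_truncation, ← Finset.sum_add_distrib, hA', map_mul, Complex.conj_ofReal]
    refine Finset.sum_congr rfl fun i _ => Finset.sum_congr rfl fun j _ => ?_
    have h1 : ((a i : ℂ) ^ 2 + (a j : ℂ) ^ 2) ≠ 0 := by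
      have : (0 : ℝ) < a i ^ 2 + a j ^ 2 := by have := ha i; have := ha j; positivity
      exact_mod_cast this.ne'
    push_cast
    field_simp

end IsBoundedMatrix

variable {H : Type*} [NormedAddCommGroup H] [InnerProductSpace ℂ H]

theorem isBoundedMatrix_of_apply (e : ι → H) (he : Orthonormal ℂ e) {t : ι → ι → ℂ} {C : ℝ}
    (h : ∀ (F : Finset ι) (x y : ι → ℂ),
      ‖∑ i ∈ F, ∑ j ∈ F, starRingEnd ℂ (x i) * t i j * y j‖ ≤
        C * ‖∑ i ∈ F, x i • e i‖ * ‖∑ i ∈ F, y i • e i‖) : IsBoundedMatrix t := by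
  have hn : ∀ (F : Finset ι) (x : ι → ℂ), ‖∑ i ∈ F, x i • e i‖ = √(∑ i ∈ F, ‖x i‖ ^ 2) := by
    intro F x
    rw [eq_comm, Real.sqrt_eq_iff_mul_self_eq (by positivity) (norm_nonneg _), ← pow_two,
      ← inner_self_eq_norm_sq (𝕜 := ℂ), he.inner_sum, map_sum]
    refine Finset.sum_congr rfl fun i _ => ?_
    rw [RCLike.conj_mul]
    norm_cast
  refine ⟨C, fun F x y => ?_⟩
  rw [← hn, ← hn]
  exact h F x y

variable [CompleteSpace H]

/-- A bounded matrix is the matrix of a bounded operator. -/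
theorem IsBoundedMatrix.exists_operator {t : ι → ι → ℂ} (ht : IsBoundedMatrix t)
    (e : HilbertBasis ι ℂ H) : ∃ T : H →L[ℂ] H, ∀ i j, ⟪e i, T (e j)⟫_ℂ = t i j := by
  classical
  obtain ⟨C, hC0, hC⟩ := ht.exists_nonneg
  let B : Finset ι → H → H → ℂ := fun F x y =>
    ∑ i ∈ F, ∑ j ∈ F, ⟪x, e i⟫_ℂ * t i j * ⟪e j, y⟫_ℂ
  have hB : ∀ F x y, ‖B F x y‖ ≤ C * ‖x‖ * ‖y‖ := by
    intro F x y
    have h1 := hC F (fun i => ⟪e i, x⟫_ℂ) (fun i => ⟪e i, y⟫_ℂ)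
    simp only [inner_conj_symm] at h1
    have h2 : ∀ z : H, √(∑ i ∈ F, ‖⟪e i, z⟫_ℂ‖ ^ 2) ≤ ‖z‖ := fun z =>
      (Real.sqrt_le_sqrt (e.orthonormal.sum_inner_products_le z)).trans_eq
        (Real.sqrt_sq (norm_nonneg _))
    exact h1.trans (mul_le_mul (mul_le_mul_of_nonneg_left (h2 x) hC0) (h2 y)
      (Real.sqrt_nonneg _) (by positivity))
  -- Along an ultrafilter the bounded truncated forms converge by compactness alone; sesquilinearity
  -- and the bound pass to the limit.
  let U : Ultrafilter (Finset ι) := Ultrafilter.of atTop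
  have hlim : ∀ x y, ∃ l ∈ Metric.closedBall (0 : ℂ) (C * ‖x‖ * ‖y‖),
      Tendsto (fun F => B F x y) U (𝓝 l) := by
    intro x y
    refine (isCompact_closedBall (0 : ℂ) (C * ‖x‖ * ‖y‖)).ultrafilter_le_nhds
      (U.map fun F => B F x y) ?_
    rw [le_principal_iff]
    exact Filter.mem_map.mpr (Filter.mem_of_superset univ_mem fun F _ =>
      mem_closedBall_zero_iff.mpr (hB F x y))
  choose L hL1 hL2 using hlim
  let S : H →ₗ⋆[ℂ] H →ₗ[ℂ] ℂ := LinearMap.mk₂'ₛₗ (starRingEnd ℂ) (RingHom.id ℂ) L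
    (fun x x' y => tendsto_nhds_unique (hL2 _ _) (((hL2 x y).add (hL2 x' y)).congr fun F => by
      simp only [B, inner_add_left, add_mul, Finset.sum_add_distrib]))
    (fun c x y => tendsto_nhds_unique (hL2 _ _) (((hL2 x y).const_mul _).congr fun F => by
      simp only [B, inner_smul_left, Finset.mul_sum, mul_assoc]))
    (fun x y y' => tendsto_nhds_unique (hL2 _ _) (((hL2 x y).add (hL2 x y')).congr fun F => by
      simp only [B, inner_add_right, mul_add, Finset.sum_add_distrib]))
    (fun c x y => tendsto_nhds_unique (hL2 _ _) (((hL2 x y).const_mul _).congr fun F => by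
      simp only [B, inner_smul_right, Finset.mul_sum, RingHom.id_apply]
      refine Finset.sum_congr rfl fun i _ => Finset.sum_congr rfl fun j _ => ?_
      ring))
  let S' : H →L⋆[ℂ] H →L[ℂ] ℂ := S.mkContinuous₂ C fun x y =>
    mem_closedBall_zero_iff.mp (hL1 x y)
  refine ⟨(InnerProductSpace.continuousLinearMapOfBilin S').adjoint, fun i j => ?_⟩
  rw [ContinuousLinearMap.adjoint_inner_right,
    InnerProductSpace.continuousLinearMapOfBilin_apply]
  change L (e i) (e j) = t i j
  refine tendsto_nhds_unique (hL2 _ _) (tendsto_const_nhds.congr' ?_)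
  -- On basis vectors the truncated form is constant as soon as F contains both indices.
  have hev : ∀ᶠ F : Finset ι in U, {i, j} ≤ F :=
    Ultrafilter.of_le (atTop : Filter (Finset ι)) (mem_atTop {i, j})
  filter_upwards [hev] with F hF
  have hi : i ∈ F := hF (by simp)
  have hj : j ∈ F := hF (by simp)
  simp only [B, orthonormal_iff_ite.mp e.orthonormal]
  simp [hi, hj]

end BoundedMatrix

end NCG

end

noncomputable section

namespace NCG

/-! ### Commutators with diagonal weights -/

section Weights

variable {ι : Type*} {t : ι → ι → ℂ}

/-- The kernel is qᵢ⁻¹ times the square of √(qᵢ qⱼ)/(qᵢ + qⱼ): two applications of `hadamard_mean`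
with aᵢ = √qᵢ, then a diagonal factor of size at most 1. -/
theorem IsBoundedMatrix.hadamard_kernel (ht : IsBoundedMatrix t) {q : ι → ℝ} (hq : ∀ i, 1 ≤ q i) :
    IsBoundedMatrix fun i j => ((q j / (q i + q j) ^ 2 : ℝ) : ℂ) * t i j := by
  have hq0 : ∀ i, 0 < q i := fun i => one_pos.trans_le (hq i)
  have h1 := (ht.hadamard_mean (a := fun i => √(q i)) fun i => Real.sqrt_pos.mpr (hq0 i)).hadamard_mean
    (a := fun i => √(q i)) fun i => Real.sqrt_pos.mpr (hq0 i)
  have h2 := h1.left_mul (a := fun i => (((q i)⁻¹ : ℝ) : ℂ)) (b := 1) fun i => by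
    rw [Complex.norm_real, Real.norm_of_nonneg (inv_nonneg.mpr (hq0 i).le)]
    exact inv_le_one_of_one_le₀ (hq i)
  convert h2 using 3 with i j
  rw [← mul_assoc, ← mul_assoc, ← Complex.ofReal_mul, ← Complex.ofReal_mul]
  congr 2
  rw [Real.sq_sqrt (hq0 i).le, Real.sq_sqrt (hq0 j).le]
  have h3 : √(q i) * √(q j) / (q i + q j) * (√(q i) * √(q j) / (q i + q j)) =
      √(q i) ^ 2 * √(q j) ^ 2 / (q i + q j) ^ 2 := by
    rw [div_mul_div_comm]
    congr 1 <;> ring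
  have h4 := (hq0 i).ne'
  rw [mul_assoc, h3, Real.sq_sqrt (hq0 i).le, Real.sq_sqrt (hq0 j).le]
  field_simp

/-- Bounds on the iterated commutators with `Q²`, relative to powers of `Q`, give bounds on the
iterated commutators with `Q`. -/
theorem isBoundedMatrix_commutator_of_sq {q : ι → ℝ} (hq : ∀ i, 1 ≤ q i)
    (h : ∀ n : ℕ, IsBoundedMatrix fun i j => (((q i ^ 2 - q j ^ 2) / q j : ℝ) : ℂ) ^ n * t i j)
    (n : ℕ) : IsBoundedMatrix fun i j => ((q i - q j : ℝ) : ℂ) ^ n * t i j := by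
  have hq0 : ∀ i, 0 < q i := fun i => one_pos.trans_le (hq i)
  -- Here m counts the multipliers qⱼ/(qᵢ + qⱼ) still to be absorbed. Absorbing one may use up one
  -- more commutator, so n has to stay arbitrary in the induction.
  have key : ∀ m n : ℕ, IsBoundedMatrix fun i j => ((q j / (q i + q j) : ℝ) : ℂ) ^ m *
      ((((q i ^ 2 - q j ^ 2) / q j : ℝ) : ℂ) ^ n * t i j) := by
    intro m
    induction m with
    | zero => simpa using h
    | succ m ih =>
      intro n
      have h1 := ((ih n).const_mul (1 / 2)).sub
        (((ih (n + 1)).hadamard_kernel hq).const_mul (1 / 2))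
      convert h1 using 3 with i j
      have h2 : ((q j / (q i + q j) : ℝ) : ℂ) = 1 / 2 - 1 / 2 * (((q j / (q i + q j) ^ 2 : ℝ) : ℂ) *
          (((q i ^ 2 - q j ^ 2) / q j : ℝ) : ℂ)) := by
        have h3 : q j / (q i + q j) =
            1 / 2 - 1 / 2 * (q j / (q i + q j) ^ 2 * ((q i ^ 2 - q j ^ 2) / q j)) := by
          have := (hq0 j).ne'
          have := (add_pos (hq0 i) (hq0 j)).ne'
          field_simp
          ring
        rw [h3]
        push_cast
        rfl
      rw [pow_succ]
      generalize ((q j / (q i + q j) : ℝ) : ℂ) ^ m = c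
      rw [h2]
      ring
  -- For m = n the two weights multiply to (qᵢ − qⱼ)ⁿ.
  convert key n n using 3 with i j
  rw [← mul_assoc, ← mul_pow, ← Complex.ofReal_mul]
  congr 3
  have := (hq0 j).ne'
  have := (add_pos (hq0 i) (hq0 j)).ne'
  field_simp
  ring

/-- Iterated commutators remain bounded when `Q` is changed by a bounded function. -/
theorem isBoundedMatrix_commutator_of_sub_bounded {p q : ι → ℝ} {b : ℝ}
    (hpq : ∀ i, |q i - p i| ≤ b)
    (h : ∀ n : ℕ, IsBoundedMatrix fun i j => ((q i - q j : ℝ) : ℂ) ^ n * t i j)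
    (n : ℕ) : IsBoundedMatrix fun i j => ((p i - p j : ℝ) : ℂ) ^ n * t i j := by
  -- Trade the factors one at a time through pᵢ − pⱼ = (qᵢ − qⱼ) − (qᵢ − pᵢ) + (qⱼ − pⱼ), whose last
  -- two terms are bounded diagonal multipliers.
  suffices key : ∀ m n : ℕ, IsBoundedMatrix fun i j => ((q i - q j : ℝ) : ℂ) ^ n *
      (((p i - p j : ℝ) : ℂ) ^ m * t i j) by simpa using key n 0
  intro m
  induction m with
  | zero => simpa using h
  | succ m ih =>
    intro n
    have hb : ∀ i, ‖((q i - p i : ℝ) : ℂ)‖ ≤ b := fun i => by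
      rw [Complex.norm_real]; exact hpq i
    have h1 := ((ih (n + 1)).sub ((ih n).left_mul hb)).add ((ih n).right_mul hb)
    convert h1 using 3 with i j
    push_cast
    ring

end Weights

end NCG

end

noncomputable section

namespace NCG

/-! ### Operators of finite order and the modulus -/

open Filter Topology

section AbstractOrder

variable {Λ : Type*} [Ring Λ] [Algebra ℂ Λ]

/-- The elements of order at most `k` in the algebra generated by `B` and `P`: the combinations of
the elements `X * P ^ j` with `X ∈ B` and `j ≤ k`. -/
def orderFiltration (B : Subalgebra ℂ Λ) (P : Λ) (k : ℕ) : Submodule ℂ Λ :=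
  Submodule.span ℂ {Y | ∃ X ∈ B, ∃ j ≤ k, Y = X * P ^ j}

variable {B : Subalgebra ℂ Λ} {P : Λ}

theorem mul_pow_mem_orderFiltration {X : Λ} (hX : X ∈ B) {j k : ℕ} (hj : j ≤ k) :
    X * P ^ j ∈ orderFiltration B P k :=
  Submodule.subset_span ⟨X, hX, j, hj, rfl⟩

theorem mem_orderFiltration_of_mem {X : Λ} (hX : X ∈ B) (k : ℕ) : X ∈ orderFiltration B P k := by
  simpa using mul_pow_mem_orderFiltration (P := P) hX (Nat.zero_le k)

theorem orderFiltration_mono {k l : ℕ} (h : k ≤ l) :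
    orderFiltration B P k ≤ orderFiltration B P l :=
  Submodule.span_mono fun _ ⟨X, hX, j, hj, e⟩ => ⟨X, hX, j, hj.trans h, e⟩

theorem orderFiltration_induction {k : ℕ} (f : Λ →ₗ[ℂ] Λ) {N : Submodule ℂ Λ}
    (h : ∀ X ∈ B, ∀ j ≤ k, f (X * P ^ j) ∈ N) {Y : Λ} (hY : Y ∈ orderFiltration B P k) :
    f Y ∈ N := by
  have : orderFiltration B P k ≤ N.comap f := by
    refine Submodule.span_le.mpr ?_
    rintro _ ⟨X, hX, j, hj, rfl⟩
    exact h X hX j hj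
  exact this hY

theorem mul_mem_orderFiltration_of_mem {X Y : Λ} (hX : X ∈ B) {k : ℕ}
    (hY : Y ∈ orderFiltration B P k) : X * Y ∈ orderFiltration B P k := by
  refine orderFiltration_induction (LinearMap.mulLeft ℂ X) (fun X' hX' j hj => ?_) hY
  rw [LinearMap.mulLeft_apply, ← mul_assoc]
  exact mul_pow_mem_orderFiltration (B.mul_mem hX hX') hj

/-- Moving P to the right past X ∈ B costs [P, X] ∈ B, which does not raise the order. -/
theorem pow_mul_mem_orderFiltration (hB : ∀ X ∈ B, P * X - X * P ∈ B) {k : ℕ} (l : ℕ) {Y : Λ}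
    (hY : Y ∈ orderFiltration B P k) : P ^ l * Y ∈ orderFiltration B P (l + k) := by
  induction l with
  | zero => simpa using hY
  | succ l ih =>
    rw [pow_succ', mul_assoc, add_right_comm]
    refine orderFiltration_induction (LinearMap.mulLeft ℂ P) (fun X hX j hj => ?_) ih
    have : P * (X * P ^ j) = X * P ^ (j + 1) + (P * X - X * P) * P ^ j := by
      rw [pow_succ']; noncomm_ring
    rw [LinearMap.mulLeft_apply, this]
    exact Submodule.add_mem _ (mul_pow_mem_orderFiltration hX (by omega))
      (mul_pow_mem_orderFiltration (hB X hX) (by omega))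

theorem mul_mem_orderFiltration (hB : ∀ X ∈ B, P * X - X * P ∈ B) {k l : ℕ} {Y Z : Λ}
    (hY : Y ∈ orderFiltration B P k) (hZ : Z ∈ orderFiltration B P l) :
    Y * Z ∈ orderFiltration B P (k + l) := by
  refine orderFiltration_induction (LinearMap.mulRight ℂ Z) (fun X hX j hj => ?_) hY
  rw [LinearMap.mulRight_apply, mul_assoc]
  exact mul_mem_orderFiltration_of_mem hX
    (orderFiltration_mono (by omega) (pow_mul_mem_orderFiltration hB j hZ))

/-- Since [P², X] = P[P, X] + [P, X]P, the commutator with P² adds one to the order, not two. -/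
theorem commutator_sq_mem_orderFiltration (hB : ∀ X ∈ B, P * X - X * P ∈ B) {k : ℕ} {Y : Λ}
    (hY : Y ∈ orderFiltration B P k) :
    P ^ 2 * Y - Y * P ^ 2 ∈ orderFiltration B P (k + 1) := by
  refine orderFiltration_induction (LinearMap.mulLeft ℂ (P ^ 2) - LinearMap.mulRight ℂ (P ^ 2))
    (fun X hX j hj => ?_) hY
  have : P ^ 2 * (X * P ^ j) - X * P ^ j * P ^ 2 =
      P ^ 1 * ((P * X - X * P) * P ^ j) + (P * X - X * P) * P ^ (j + 1) := by
    have h1 : P ^ j * P ^ 2 = P ^ 2 * P ^ j := by rw [← pow_add, ← pow_add, add_comm]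
    rw [mul_assoc X, h1, pow_succ' P j]; noncomm_ring
  rw [LinearMap.sub_apply, LinearMap.mulLeft_apply, LinearMap.mulRight_apply, this]
  exact Submodule.add_mem _
    (orderFiltration_mono (by omega) (pow_mul_mem_orderFiltration hB 1
      (mul_pow_mem_orderFiltration (hB X hX) hj)))
    (mul_pow_mem_orderFiltration (hB X hX) (by omega))

end AbstractOrder

variable {H : Type*} [NormedAddCommGroup H] [InnerProductSpace ℂ H]

/-! ### Domains of powers and smooth vectors -/

section DomPow

variable {D : H →ₗ.[ℂ] H}

theorem mem_domPow_succ {k : ℕ} {u : H} :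
    u ∈ domPow D (k + 1) ↔ ∃ v, (u, v) ∈ D.graph ∧ v ∈ domPow D k := by
  constructor
  · rintro ⟨y, hy, rfl⟩
    exact ⟨D y, D.mem_graph y, hy⟩
  · rintro ⟨v, huv, hv⟩
    obtain ⟨y, rfl, rfl⟩ := D.mem_graph_iff.mp huv
    exact ⟨y, hv, rfl⟩

theorem domPow_succ_le (k : ℕ) : domPow D (k + 1) ≤ domPow D k := by
  induction k with
  | zero => exact le_top
  | succ k ih =>
    intro u hu
    obtain ⟨v, huv, hv⟩ := mem_domPow_succ.mp hu
    exact mem_domPow_succ.mpr ⟨v, huv, ih hv⟩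

theorem mem_smooth {u : H} : u ∈ smooth D ↔ ∀ k, u ∈ domPow D k := Submodule.mem_iInf _

theorem smoothOp_mem_graph [CompleteSpace H] (ξ : smooth D) :
    ((ξ : H), (smoothOp D ξ : H)) ∈ D.graph :=
  D.mem_graph ⟨ξ, smooth_le_domain D ξ.2⟩

theorem le_smooth {W : Submodule ℂ H} (h : ∀ u ∈ W, ∃ v ∈ W, (u, v) ∈ D.graph) :
    W ≤ smooth D := by
  intro u hu
  refine mem_smooth.mpr fun k => ?_
  induction k generalizing u with
  | zero => exact Submodule.mem_top
  | succ k ih =>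
    obtain ⟨v, hv, huv⟩ := h u hu
    exact mem_domPow_succ.mpr ⟨v, huv, ih hv⟩

end DomPow

/-! ### Self-adjoint operators with the same square -/

variable [CompleteSpace H] {D P : H →ₗ.[ℂ] H}

theorem norm_eq_of_sq (hD : IsSelfAdjoint D) (hP : IsSelfAdjoint P) {u v v' w : H}
    (h1 : (u, v) ∈ D.graph) (h2 : (v, w) ∈ D.graph) (h3 : (u, v') ∈ P.graph)
    (h4 : (v', w) ∈ P.graph) : ‖v‖ = ‖v'‖ := by
  have h5 : ⟪v, v⟫_ℂ = ⟪v', v'⟫_ℂ :=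
    (inner_graph_symm hD h2 h1).trans (inner_graph_symm hP h4 h3).symm
  have h6 : ‖v‖ ^ 2 = ‖v'‖ ^ 2 := by
    rw [← inner_self_eq_norm_sq (𝕜 := ℂ), ← inner_self_eq_norm_sq (𝕜 := ℂ), h5]
  exact (pow_left_inj₀ (norm_nonneg _) (norm_nonneg _) two_ne_zero).mp h6

/-- The domain of `D²` is a core for `D`. -/
theorem exists_seq_of_mem_graph (hD : IsSelfAdjoint D) {u v : H} (huv : (u, v) ∈ D.graph) :
    ∃ a b c : ℕ → H, (∀ n, (a n, b n) ∈ D.graph) ∧ (∀ n, (b n, c n) ∈ D.graph) ∧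
      Tendsto a atTop (𝓝 u) ∧ Tendsto b atTop (𝓝 v) := by
  let G : Submodule ℂ (WithLp 2 (H × H)) :=
    { carrier := {z | (z.fst, z.snd) ∈ D.graph ∧ ∃ w, (z.snd, w) ∈ D.graph}
      add_mem' := fun ⟨h1, w, h2⟩ ⟨h3, w', h4⟩ =>
        ⟨D.graph.add_mem h1 h3, w + w', D.graph.add_mem h2 h4⟩
      zero_mem' := ⟨D.graph.zero_mem, 0, D.graph.zero_mem⟩
      smul_mem' := fun c _ ⟨h1, w, h2⟩ =>
        ⟨D.graph.smul_mem c h1, c • w, D.graph.smul_mem c h2⟩ }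
  have hG : G.topologicalClosure ≤ closedGraph D :=
    G.topologicalClosure_minimal (fun z hz => (mem_closedGraph hD z).mpr hz.1)
      (Submodule.isClosed_topologicalClosure _)
  set z : WithLp 2 (H × H) := WithLp.toLp 2 (u, v)
  set p := G.topologicalClosure.starProjection z with hp
  have hpK : p ∈ G.topologicalClosure := Submodule.starProjection_apply_mem _ _
  have hd : ((z - p).fst, (z - p).snd) ∈ D.graph :=
    (mem_closedGraph hD _).mp (Submodule.sub_mem _ ((mem_closedGraph hD z).mpr huv) (hG hpK))
  -- The remainder (w, Dw) is orthogonal to every (Rx, DRx) with R = (1 + D²)⁻¹, which says ⟪x, w⟫ =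
  -- ⟪(1 + D²)Rx, w⟫ = 0 for all x.
  have h0 : (z - p).fst = 0 := by
    refine ext_inner_left ℂ fun x => ?_
    obtain ⟨y, h1, h2⟩ := resolventSq_spec hD x
    have h3 : WithLp.toLp 2 (resolventSq D x, y) ∈ G.topologicalClosure :=
      G.le_topologicalClosure ⟨h1, _, h2⟩
    have h4 : ⟪z - p, WithLp.toLp 2 (resolventSq D x, y)⟫_ℂ = 0 :=
      Submodule.starProjection_inner_eq_zero _ _ h3
    have h5 : ⟪WithLp.toLp 2 (resolventSq D x, y), z - p⟫_ℂ = 0 := by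
      rw [← inner_conj_symm, h4, map_zero]
    have h6 : ⟪resolventSq D x, (z - p).fst⟫_ℂ + ⟪y, (z - p).snd⟫_ℂ = 0 := h5
    rw [← inner_graph_symm hD hd h2, inner_sub_left] at h6
    rw [inner_zero_right, ← h6]
    abel
  have h1 : (z - p).snd = 0 := LinearPMap.graph_fst_eq_zero_snd D hd h0
  have hz : z ∈ closure (G : Set (WithLp 2 (H × H))) := by
    have h2 : z - p = 0 := WithLp.ofLp_injective 2 (Prod.ext h0 h1)
    rw [sub_eq_zero.mp h2]
    exact hpK
  obtain ⟨s, hs, hlim⟩ := mem_closure_iff_seq_limit.mp hz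
  choose hs1 c hc using hs
  refine ⟨fun n => (s n).fst, fun n => (s n).snd, c, hs1, hc, ?_, ?_⟩
  · exact ((WithLp.fstL 2 ℂ H H).continuous.tendsto z).comp hlim
  · exact ((WithLp.sndL 2 ℂ H H).continuous.tendsto z).comp hlim

/-- Self-adjoint operators with the same square have the same domain. -/
theorem domain_le_of_sq (hD : IsSelfAdjoint D) (hP : IsSelfAdjoint P)
    (h : ∀ u w : H, (∃ v, (u, v) ∈ D.graph ∧ (v, w) ∈ D.graph) →
      ∃ v, (u, v) ∈ P.graph ∧ (v, w) ∈ P.graph) {u v : H} (huv : (u, v) ∈ D.graph) :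
    ∃ v', (u, v') ∈ P.graph := by
  obtain ⟨a, b, c, hab, hbc, ha, hb⟩ := exists_seq_of_mem_graph hD huv
  choose b' hab' hbc' using fun n => h (a n) (c n) ⟨b n, hab n, hbc n⟩
  -- On dom D² the vectors Da and Pa have equal norms, so the P-images are Cauchy as well, and the
  -- graph of P is closed.
  have hn : ∀ m n, dist (b' m) (b' n) = dist (b m) (b n) := by
    intro m n
    rw [dist_eq_norm, dist_eq_norm]
    exact (norm_eq_of_sq hD hP (v := b m - b n) (v' := b' m - b' n) (D.graph.sub_mem (hab m) (hab n)) (D.graph.sub_mem (hbc m) (hbc n))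
      (P.graph.sub_mem (hab' m) (hab' n)) (P.graph.sub_mem (hbc' m) (hbc' n))).symm
  have hc : CauchySeq b' := by
    have := hb.cauchySeq
    rw [Metric.cauchySeq_iff] at this ⊢
    simpa only [hn] using this
  obtain ⟨v', hv'⟩ := cauchySeq_tendsto_of_complete hc
  exact ⟨v', hP.isClosed.mem_of_tendsto (ha.prodMk_nhds hv') (Eventually.of_forall hab')⟩

/-- Equality of squares gives an induction in steps of two; the odd powers need the case k = 1,
which is `domain_le_of_sq` in both directions. -/
theorem domPow_eq_of_sq (hD : IsSelfAdjoint D) (hP : IsSelfAdjoint P)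
    (h : ∀ u w : H, (∃ v, (u, v) ∈ P.graph ∧ (v, w) ∈ P.graph) ↔
      ∃ v, (u, v) ∈ D.graph ∧ (v, w) ∈ D.graph) : ∀ k, domPow P k = domPow D k
  | 0 => rfl
  | 1 => by
    ext u
    simp only [mem_domPow_succ]
    constructor
    · rintro ⟨v, hv, -⟩
      obtain ⟨v', hv'⟩ := domain_le_of_sq hP hD (fun u w => (h u w).mp) hv
      exact ⟨v', hv', Submodule.mem_top⟩
    · rintro ⟨v, hv, -⟩
      obtain ⟨v', hv'⟩ := domain_le_of_sq hD hP (fun u w => (h u w).mpr) hv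
      exact ⟨v', hv', Submodule.mem_top⟩
  | k + 2 => by
    ext u
    have ih := domPow_eq_of_sq hD hP h k
    simp only [mem_domPow_succ, ih]
    constructor
    · rintro ⟨v, hv, w, hw, hk⟩
      obtain ⟨v', h1, h2⟩ := (h u w).mp ⟨v, hv, hw⟩
      exact ⟨v', h1, w, h2, hk⟩
    · rintro ⟨v, hv, w, hw, hk⟩
      obtain ⟨v', h1, h2⟩ := (h u w).mpr ⟨v, hv, hw⟩
      exact ⟨v', h1, w, h2, hk⟩

theorem domPow_modulus (hD : IsSelfAdjoint D) (k : ℕ) : domPow (modulus D) k = domPow D k :=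
  domPow_eq_of_sq hD (modulus_spec hD).1 (modulus_spec hD).2.2 k

theorem smooth_modulus (hD : IsSelfAdjoint D) : smooth (modulus D) = smooth D :=
  iInf_congr (domPow_modulus hD)

/-- `P` as a linear operator on the smooth vectors of an operator `D` with the same smooth
vectors. -/
def transportOp (h : smooth P = smooth D) : Module.End ℂ (smooth D) where
  toFun ξ := ⟨P ⟨ξ, smooth_le_domain P (h.ge ξ.2)⟩, h.le (apply_mem_smooth P ⟨ξ, h.ge ξ.2⟩)⟩
  map_add' ξ η := Subtype.ext
    (P.map_add ⟨ξ, smooth_le_domain P (h.ge ξ.2)⟩ ⟨η, smooth_le_domain P (h.ge η.2)⟩)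
  map_smul' c ξ := Subtype.ext (P.map_smul c ⟨ξ, smooth_le_domain P (h.ge ξ.2)⟩)

theorem transportOp_mem_graph (h : smooth P = smooth D) (ξ : smooth D) :
    ((ξ : H), (transportOp h ξ : H)) ∈ P.graph :=
  P.mem_graph ⟨ξ, smooth_le_domain P (h.ge ξ.2)⟩

/-- `|D|` as a linear operator on `H^∞`. -/
def absOp (hD : IsSelfAdjoint D) : Module.End ℂ (smooth D) :=
  transportOp (smooth_modulus hD)

theorem absOp_mem_graph (hD : IsSelfAdjoint D) (ξ : smooth D) :
    ((ξ : H), (absOp hD ξ : H)) ∈ (modulus D).graph :=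
  transportOp_mem_graph (smooth_modulus hD) ξ

theorem absOp_sq (hD : IsSelfAdjoint D) : absOp hD ^ 2 = smoothOp D ^ 2 := by
  ext ξ
  rw [pow_two, pow_two, Module.End.mul_apply, Module.End.mul_apply]
  obtain ⟨v, h1, h2⟩ := ((modulus_spec hD).2.2 _ _).mp
    ⟨_, absOp_mem_graph hD ξ, absOp_mem_graph hD (absOp hD ξ)⟩
  have h3 : v = smoothOp D ξ := D.mem_graph_snd_inj h1 (smoothOp_mem_graph ξ) rfl
  exact D.mem_graph_snd_inj h2 (smoothOp_mem_graph (smoothOp D ξ)) h3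

theorem smoothOp_isSymmetric (hD : IsSelfAdjoint D) : (smoothOp D).IsSymmetric := fun ξ η =>
  inner_graph_symm hD (smoothOp_mem_graph η) (smoothOp_mem_graph ξ)

theorem absOp_isSymmetric (hD : IsSelfAdjoint D) : (absOp hD).IsSymmetric := fun ξ η =>
  inner_graph_symm (modulus_spec hD).1 (absOp_mem_graph hD η) (absOp_mem_graph hD ξ)

/-- Both squared norms equal ⟪D²ʲξ, ξ⟫. This lets elliptic estimates be stated with D although the
filtration uses |D|. -/
theorem norm_absOp_pow (hD : IsSelfAdjoint D) (j : ℕ) (ξ : smooth D) :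
    ‖(absOp hD ^ j) ξ‖ = ‖(smoothOp D ^ j) ξ‖ := by
  have h1 := (absOp_isSymmetric hD).pow j ξ ((absOp hD ^ j) ξ)
  have h2 := (smoothOp_isSymmetric hD).pow j ξ ((smoothOp D ^ j) ξ)
  rw [← Module.End.mul_apply, ← pow_add, ← two_mul, pow_mul] at h1 h2
  rw [absOp_sq, ← h2] at h1
  have h6 : ‖(absOp hD ^ j) ξ‖ ^ 2 = ‖(smoothOp D ^ j) ξ‖ ^ 2 := by
    rw [← inner_self_eq_norm_sq (𝕜 := ℂ), ← inner_self_eq_norm_sq (𝕜 := ℂ), h1]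
  exact (pow_left_inj₀ (norm_nonneg _) (norm_nonneg _) two_ne_zero).mp h6

end NCG

end

noncomputable section

namespace NCG

/-! ### Smooth elements for the derivation and the elliptic estimate -/

variable {H : Type*} [NormedAddCommGroup H] [InnerProductSpace ℂ H]

section BoundedCommutator

variable {P : H →ₗ.[ℂ] H} {T S T' S' : H →L[ℂ] H}

theorem hasBoundedCommutator_iff : HasBoundedCommutator P T S ↔
    ∀ u v, (u, v) ∈ P.graph → (T u, T v + S u) ∈ P.graph := by
  constructor
  · intro h u v huv
    obtain ⟨y, rfl, rfl⟩ := P.mem_graph_iff.mp huv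
    obtain ⟨h1, h2⟩ := h y
    exact P.mem_graph_iff.mpr ⟨⟨T y, h1⟩, rfl, by rw [← h2]; exact (add_sub_cancel _ _).symm⟩
  · intro h ξ
    obtain ⟨y, hy1, hy2⟩ := P.mem_graph_iff.mp (h ξ (P ξ) (P.mem_graph ξ))
    have h1 : T ξ ∈ P.domain := by
      have h2 : (y : H) = T ξ := hy1
      exact h2 ▸ y.2
    have h2 : y = ⟨T ξ, h1⟩ := Subtype.ext hy1
    refine ⟨h1, ?_⟩
    change P y = T (P ξ) + S ξ at hy2
    rw [← h2, hy2]
    abel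

theorem HasBoundedCommutator.add (h : HasBoundedCommutator P T S)
    (h' : HasBoundedCommutator P T' S') : HasBoundedCommutator P (T + T') (S + S') := by
  rw [hasBoundedCommutator_iff] at *
  intro u v huv
  convert P.graph.add_mem (h u v huv) (h' u v huv) using 1
  refine Prod.ext rfl ?_
  change T v + T' v + (S u + S' u) = T v + S u + (T' v + S' u)
  abel

theorem HasBoundedCommutator.smul (h : HasBoundedCommutator P T S) (c : ℂ) :
    HasBoundedCommutator P (c • T) (c • S) := by
  rw [hasBoundedCommutator_iff] at *
  intro u v huv
  convert P.graph.smul_mem c (h u v huv) using 1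
  refine Prod.ext rfl ?_
  change c • T v + c • S u = c • (T v + S u)
  rw [smul_add]

theorem HasBoundedCommutator.mul (h : HasBoundedCommutator P T S)
    (h' : HasBoundedCommutator P T' S') : HasBoundedCommutator P (T * T') (S * T' + T * S') := by
  rw [hasBoundedCommutator_iff] at *
  intro u v huv
  convert h _ _ (h' u v huv) using 1
  refine Prod.ext rfl ?_
  change T (T' v) + (S (T' u) + T (S' u)) = T (T' v + S' u) + S (T' u)
  rw [map_add]
  abel

theorem HasBoundedCommutator.one : HasBoundedCommutator P 1 0 := by
  rw [hasBoundedCommutator_iff]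
  intro u v huv
  simpa using huv

theorem HasBoundedCommutator.zero : HasBoundedCommutator P 0 0 := by
  rw [hasBoundedCommutator_iff]
  intro u v _
  simp

theorem HasBoundedCommutator.unique (hP : Dense (P.domain : Set H))
    (h : HasBoundedCommutator P T S) (h' : HasBoundedCommutator P T S') : S = S' := by
  refine DFunLike.coe_injective (S.continuous.ext_on hP S'.continuous fun u hu => ?_)
  obtain ⟨h1, h2⟩ := h ⟨u, hu⟩
  obtain ⟨_, h4⟩ := h' ⟨u, hu⟩
  exact h2.symm.trans h4

end BoundedCommutator

variable [CompleteSpace H] {D : H →ₗ.[ℂ] H} {T S : H →L[ℂ] H}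

theorem MemDomDelta.of_succ {n : ℕ} (h : MemDomDelta D (n + 1) T) : MemDomDelta D n T := by
  induction n generalizing T with
  | zero => trivial
  | succ n ih =>
    obtain ⟨S, h1, h2⟩ := h
    exact ⟨S, h1, ih h2⟩

theorem MemDomDelta.add {n : ℕ} (hT : MemDomDelta D n T) (hS : MemDomDelta D n S) :
    MemDomDelta D n (T + S) := by
  induction n generalizing T S with
  | zero => trivial
  | succ n ih =>
    obtain ⟨T', h1, h2⟩ := hT
    obtain ⟨S', h3, h4⟩ := hS
    exact ⟨_, h1.add h3, ih h2 h4⟩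

theorem MemDomDelta.smul {n : ℕ} (hT : MemDomDelta D n T) (c : ℂ) : MemDomDelta D n (c • T) := by
  induction n generalizing T with
  | zero => trivial
  | succ n ih =>
    obtain ⟨T', h1, h2⟩ := hT
    exact ⟨_, h1.smul c, ih h2⟩

theorem MemDomDelta.mul {n : ℕ} (hT : MemDomDelta D n T) (hS : MemDomDelta D n S) :
    MemDomDelta D n (T * S) := by
  induction n generalizing T S with
  | zero => trivial
  | succ n ih =>
    obtain ⟨T', h1, h2⟩ := id hT
    obtain ⟨S', h3, h4⟩ := id hS
    exact ⟨_, h1.mul h3, (ih h2 hS.of_succ).add (ih hT.of_succ h4)⟩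

theorem MemDomDelta.zero (n : ℕ) : MemDomDelta D n 0 := by
  induction n with
  | zero => trivial
  | succ n ih => exact ⟨0, .zero, ih⟩

theorem MemDomDelta.one (n : ℕ) : MemDomDelta D n 1 := by
  cases n with
  | zero => trivial
  | succ n => exact ⟨0, .one, .zero n⟩

/-- The witness S might vary with n, but a bounded commutator with a densely defined operator is
unique. -/
theorem exists_forall_memDomDelta (hD : IsSelfAdjoint D) (hT : ∀ n, MemDomDelta D n T) :
    ∃ S, HasBoundedCommutator (modulus D) T S ∧ ∀ n, MemDomDelta D n S := by
  obtain ⟨S, h1, -⟩ := hT 1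
  refine ⟨S, h1, fun n => ?_⟩
  obtain ⟨S', h2, h3⟩ := hT (n + 1)
  rwa [h1.unique (dense_domain_modulus hD) h2]

/-- Induction on k through |D|Tu = T|D|u + δ(T)u, for all smooth T at once because δ(T) appears. -/
theorem apply_mem_domPow (hD : IsSelfAdjoint D) (hT : ∀ n, MemDomDelta D n T) {k : ℕ} {u : H}
    (hu : u ∈ domPow D k) : T u ∈ domPow D k := by
  induction k generalizing T u with
  | zero => exact Submodule.mem_top
  | succ k ih =>
    obtain ⟨S, h1, h2⟩ := exists_forall_memDomDelta hD hT
    have hu' := domPow_succ_le k hu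
    rw [← domPow_modulus hD] at hu ⊢
    obtain ⟨v, huv, hv⟩ := mem_domPow_succ.mp hu
    refine mem_domPow_succ.mpr ⟨_, hasBoundedCommutator_iff.mp h1 u v huv, ?_⟩
    rw [domPow_modulus hD] at hv ⊢
    exact Submodule.add_mem _ (ih hT hv) (ih h2 hu')

theorem exists_isRestriction_of_memDomDelta (hD : IsSelfAdjoint D) (hT : ∀ n, MemDomDelta D n T) :
    ∃ X : Module.End ℂ (smooth D), IsRestriction X T :=
  ⟨T.toLinearMap.restrict fun _ hu =>
    mem_smooth.mpr fun k => apply_mem_domPow hD hT (mem_smooth.mp hu k), fun _ => rfl⟩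

/-- The algebra of the restrictions to `H^∞` of the operators in `⋂ₖ dom δ ^ k`. -/
def deltaSmooth (D : H →ₗ.[ℂ] H) : Subalgebra ℂ (Module.End ℂ (smooth D)) where
  carrier := {X | ∃ T : H →L[ℂ] H, IsRestriction X T ∧ ∀ n, MemDomDelta D n T}
  mul_mem' := by
    rintro X Y ⟨T, h1, h2⟩ ⟨S, h3, h4⟩
    refine ⟨T * S, fun ξ => ?_, fun n => (h2 n).mul (h4 n)⟩
    rw [Module.End.mul_apply, h1, h3]
    rfl
  add_mem' := by
    rintro X Y ⟨T, h1, h2⟩ ⟨S, h3, h4⟩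
    refine ⟨T + S, fun ξ => ?_, fun n => (h2 n).add (h4 n)⟩
    rw [LinearMap.add_apply, Submodule.coe_add, h1, h3]
    rfl
  algebraMap_mem' c :=
    ⟨c • 1, fun _ => rfl, fun n => (MemDomDelta.one n).smul c⟩

theorem commutator_absOp_mem_deltaSmooth (hD : IsSelfAdjoint D) {X : Module.End ℂ (smooth D)}
    (hX : X ∈ deltaSmooth D) : absOp hD * X - X * absOp hD ∈ deltaSmooth D := by
  obtain ⟨T, h1, h2⟩ := hX
  obtain ⟨S, h3, h4⟩ := exists_forall_memDomDelta hD h2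
  refine ⟨S, fun ξ => ?_, h4⟩
  have h5 := hasBoundedCommutator_iff.mp h3 _ _ (absOp_mem_graph hD ξ)
  have h6 : T (absOp hD ξ) + S ξ = absOp hD (X ξ) :=
    (modulus D).mem_graph_snd_inj h5 (absOp_mem_graph hD (X ξ)) (h1 ξ).symm
  rw [LinearMap.sub_apply, Submodule.coe_sub, Module.End.mul_apply, Module.End.mul_apply, h1, ← h6]
  abel

/-- The basic elliptic estimate. -/
theorem exists_norm_apply_le (hD : IsSelfAdjoint D) {k : ℕ} {Y : Module.End ℂ (smooth D)}
    (hY : Y ∈ orderFiltration (deltaSmooth D) (absOp hD) k) :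
    ∃ C, 0 ≤ C ∧ ∀ ξ, ‖Y ξ‖ ≤ C * ∑ j ∈ Finset.range (k + 1), ‖(smoothOp D ^ j) ξ‖ := by
  induction hY using Submodule.span_induction with
  | mem Y hY =>
    obtain ⟨X, ⟨T, hT, -⟩, j, hj, rfl⟩ := hY
    refine ⟨‖T‖, norm_nonneg _, fun ξ => ?_⟩
    rw [Module.End.mul_apply, Submodule.coe_norm, hT]
    refine (T.le_opNorm _).trans (mul_le_mul_of_nonneg_left ?_ (norm_nonneg _))
    rw [← Submodule.coe_norm, norm_absOp_pow]
    exact Finset.single_le_sum (f := fun j => ‖(smoothOp D ^ j) ξ‖) (fun _ _ => norm_nonneg _)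
      (Finset.mem_range.mpr (by omega))
  | zero => exact ⟨0, le_rfl, fun ξ => by simp⟩
  | add Y Z _ _ h1 h2 =>
    obtain ⟨C, hC, h1⟩ := h1
    obtain ⟨C', hC', h2⟩ := h2
    refine ⟨C + C', add_nonneg hC hC', fun ξ => ?_⟩
    rw [add_mul]
    exact (norm_add_le _ _).trans (add_le_add (h1 ξ) (h2 ξ))
  | smul c Y _ h1 =>
    obtain ⟨C, hC, h1⟩ := h1
    refine ⟨‖c‖ * C, by positivity, fun ξ => ?_⟩
    rw [LinearMap.smul_apply, norm_smul, mul_assoc]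
    exact mul_le_mul_of_nonneg_left (h1 ξ) (norm_nonneg _)

/-! ### Orders of differential operators -/

section DiffOrder

variable {D₀ : Subalgebra ℂ (Module.End ℂ (smooth D))}

theorem map_commMap_le (hD : IsSelfAdjoint D) {k : ℕ}
    {N : Submodule ℂ (Module.End ℂ (smooth D))}
    (hN : N ≤ orderFiltration (deltaSmooth D) (absOp hD) k) :
    N.map (commMap (smoothOp D ^ 2)) ≤ orderFiltration (deltaSmooth D) (absOp hD) (k + 1) := by
  rintro _ ⟨Y, hY, rfl⟩
  rw [← absOp_sq hD]
  exact commutator_sq_mem_orderFiltration (fun X hX => commutator_absOp_mem_deltaSmooth hD hX)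
    (hN hY)

/-- The abstract filtration is closed under the operations that build the pieces: products add
orders and the commutator with D² = |D|² adds one. -/
theorem diffPiece_le (hD : IsSelfAdjoint D) (hD₀ : D₀ ≤ deltaSmooth D) (k : ℕ) :
    diffPiece D D₀ k ≤ orderFiltration (deltaSmooth D) (absOp hD) k := by
  have hB : ∀ X ∈ deltaSmooth D, absOp hD * X - X * absOp hD ∈ deltaSmooth D :=
    fun X hX => commutator_absOp_mem_deltaSmooth hD hX
  induction k using Nat.strong_induction_on with
  | h k ih =>
    cases k with
    | zero =>
      rw [diffPiece]
      exact fun X hX => mem_orderFiltration_of_mem (hD₀ hX) 0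
    | succ k =>
      rw [diffPiece]
      have h1 := map_commMap_le hD (ih k (Nat.lt_succ_self k))
      refine sup_le (sup_le (iSup_le fun j => ?_) h1) ?_
      · refine Submodule.mul_le.mpr fun X hX Y hY => ?_
        have h2 := mul_mem_orderFiltration hB (ih _ (by omega) hX) (ih _ (by omega) hY)
        exact orderFiltration_mono (by omega) h2
      · refine Submodule.mul_le.mpr fun X hX Y hY => ?_
        exact mul_mem_orderFiltration_of_mem (hD₀ hX) (h1 hY)

theorem diffOrder_le (hD : IsSelfAdjoint D) (hD₀ : D₀ ≤ deltaSmooth D) (k : ℕ) :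
    diffOrder D D₀ k ≤ orderFiltration (deltaSmooth D) (absOp hD) k :=
  iSup_le fun j => (diffPiece_le hD hD₀ j).trans (orderFiltration_mono (by omega))

theorem mem_diffOrder_zero {X : Module.End ℂ (smooth D)} (hX : X ∈ D₀) : X ∈ diffOrder D D₀ 0 := by
  refine Submodule.mem_iSup_of_mem (0 : Fin 1) ?_
  change X ∈ diffPiece D D₀ 0
  rw [diffPiece]
  exact hX

theorem commMap_sq_mem_diffOrder {k : ℕ} {X : Module.End ℂ (smooth D)}
    (hX : X ∈ diffOrder D D₀ k) : commMap (smoothOp D ^ 2) X ∈ diffOrder D D₀ (k + 1) := by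
  suffices h : diffOrder D D₀ k ≤ (diffOrder D D₀ (k + 1)).comap (commMap (smoothOp D ^ 2)) from
    h hX
  refine iSup_le fun j Y hY => Submodule.mem_iSup_of_mem j.succ ?_
  rw [Fin.val_succ, diffPiece]
  exact Submodule.mem_sup_left (Submodule.mem_sup_right ⟨Y, hY, rfl⟩)

/-- Split [(D + m)², ·] as [D², ·] plus the commutator with the difference of squares; the
hypothesis makes the second part raise the order by at most one, as the first does. -/
theorem commMap_pow_mem_diffOrder {m X : Module.End ℂ (smooth D)}
    (h : ∀ k, ∀ T ∈ diffOrder D D₀ k,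
      commMap ((smoothOp D + m) ^ 2 - smoothOp D ^ 2) T ∈ diffOrder D D₀ (k + 1))
    (hX : X ∈ D₀) (n : ℕ) : (commMap ((smoothOp D + m) ^ 2) ^ n) X ∈ diffOrder D D₀ n := by
  induction n with
  | zero => exact mem_diffOrder_zero hX
  | succ n ih =>
    rw [pow_succ', Module.End.mul_apply]
    have h1 := Submodule.add_mem _ (h n _ ih) (commMap_sq_mem_diffOrder ih)
    generalize (commMap ((smoothOp D + m) ^ 2) ^ n) X = Y at h1 ⊢
    convert h1 using 1
    simp only [commMap, LinearMap.sub_apply, LinearMap.mulLeft_apply, LinearMap.mulRight_apply,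
      sub_mul, mul_sub]
    abel

end DiffOrder

/-- The powers of `D` are dominated by those of a perturbation of `D` by an operator of order
zero. -/
theorem exists_norm_pow_le (hD : IsSelfAdjoint D) {m : Module.End ℂ (smooth D)}
    (hm : m ∈ deltaSmooth D) (n : ℕ) :
    ∃ C, 0 ≤ C ∧ ∀ ξ, ‖(smoothOp D ^ n) ξ‖ ≤
      C * ∑ j ∈ Finset.range (n + 1), ‖((smoothOp D + m) ^ j) ξ‖ := by
  induction n using Nat.strong_induction_on with
  | h n ih =>
    cases n with
    | zero => exact ⟨1, zero_le_one, fun ξ => by simp⟩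
    | succ n =>
      have hB : ∀ X ∈ deltaSmooth D, absOp hD * X - X * absOp hD ∈ deltaSmooth D :=
        fun X hX => commutator_absOp_mem_deltaSmooth hD hX
      -- In Dⁿ⁺¹ = Dⁿ(D + m) − Dⁿm the last term has the norm of |D|ⁿm, of order at most n, so only
      -- powers of D up to n occur and the induction hypothesis covers them.
      obtain ⟨C₀, hC₀, h₀⟩ := exists_norm_apply_le hD
        (pow_mul_mem_orderFiltration hB n (mem_orderFiltration_of_mem hm 0))
      choose! C hC h using fun j (hj : j < n + 1) => ih j hj
      have hmono : ∀ (ξ : smooth D) {k : ℕ}, k ≤ n + 2 →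
          ∑ j ∈ Finset.range k, ‖((smoothOp D + m) ^ j) ξ‖ ≤
            ∑ j ∈ Finset.range (n + 2), ‖((smoothOp D + m) ^ j) ξ‖ := fun ξ k hk =>
        Finset.sum_le_sum_of_subset_of_nonneg (Finset.range_mono hk) fun _ _ _ => norm_nonneg _
      refine ⟨C n + C₀ * ∑ j ∈ Finset.range (n + 1), C j,
        add_nonneg (hC n (by omega)) (mul_nonneg hC₀ (Finset.sum_nonneg fun j hj =>
          hC j (Finset.mem_range.mp hj))), fun ξ => ?_⟩
      set s := ∑ j ∈ Finset.range (n + 1 + 1), ‖((smoothOp D + m) ^ j) ξ‖ with hs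
      have h1 : (smoothOp D ^ (n + 1)) ξ =
          (smoothOp D ^ n) ((smoothOp D + m) ξ) - (smoothOp D ^ n) (m ξ) := by
        rw [pow_succ, Module.End.mul_apply, LinearMap.add_apply, map_add]
        abel
      have h2 : ‖(smoothOp D ^ n) ((smoothOp D + m) ξ)‖ ≤ C n * s := by
        refine (h n (by omega) _).trans (mul_le_mul_of_nonneg_left ?_ (hC n (by omega)))
        rw [hs, Finset.sum_range_succ' _ (n + 1)]
        refine (le_of_eq ?_).trans (le_add_of_nonneg_right (norm_nonneg _))
        refine Finset.sum_congr rfl fun j _ => ?_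
        rw [pow_succ, Module.End.mul_apply]
      have h3 : ‖(smoothOp D ^ n) (m ξ)‖ ≤ C₀ * ∑ j ∈ Finset.range (n + 1), C j * s := by
        rw [← norm_absOp_pow hD]
        refine (h₀ ξ).trans (mul_le_mul_of_nonneg_left ?_ hC₀)
        refine Finset.sum_le_sum fun j hj => ?_
        have hj' := Finset.mem_range.mp hj
        exact (h j hj' ξ).trans (mul_le_mul_of_nonneg_left (hmono ξ (by omega)) (hC j hj'))
      rw [h1]
      refine (norm_sub_le _ _).trans ((add_le_add h2 h3).trans_eq ?_)
      rw [← Finset.sum_mul]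
      ring

end NCG

end

noncomputable section

namespace NCG

/-! ### Eigenbases and bounded perturbations -/

open Filter Topology

universe u

variable {H : Type u} [NormedAddCommGroup H] [InnerProductSpace ℂ H]

section CompactResolvent

variable {D : H →ₗ.[ℂ] H}

/-- With B = DS one has S = (D − z)⁻¹(B − zS), a compact operator times a bounded one. -/
theorem isCompactOperator_of_mem_graph (hc : HasCompactResolvent D) {S B : H →L[ℂ] H}
    (h : ∀ x, (S x, B x) ∈ D.graph) : IsCompactOperator S := by
  obtain ⟨z, R, hR, -, hR2⟩ := hc
  have : S = R ∘L (B - z • S) := by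
    ext x
    have h1 := hR2 ⟨S x, LinearPMap.mem_domain_of_mem_graph (h x)⟩
    have h2 : D ⟨S x, LinearPMap.mem_domain_of_mem_graph (h x)⟩ = B x :=
      D.mem_graph_snd_inj (D.mem_graph _) (h x) rfl
    rw [h2] at h1
    exact h1.symm
  rw [this]
  exact hR.comp_clm _

theorem mem_domPow_of_sq_eigenvector {u v : H} {c : ℂ} (h1 : (u, v) ∈ D.graph)
    (h2 : (v, c • u) ∈ D.graph) (k : ℕ) : u ∈ domPow D k ∧ v ∈ domPow D k := by
  induction k with
  | zero => exact ⟨Submodule.mem_top, Submodule.mem_top⟩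
  | succ k ih =>
    exact ⟨mem_domPow_succ.mpr ⟨v, h1, ih.2⟩,
      mem_domPow_succ.mpr ⟨_, h2, Submodule.smul_mem _ c ih.1⟩⟩

theorem mem_graph_perturb {M : H →L[ℂ] H} {u v : H} :
    (u, v) ∈ (perturb D M).graph ↔ (u, v - M u) ∈ D.graph := by
  constructor
  · intro h
    obtain ⟨y, rfl, rfl⟩ := LinearPMap.mem_graph_iff _ |>.mp h
    refine D.mem_graph_iff.mpr ⟨y, rfl, ?_⟩
    change D y = M y + D y - M y
    abel
  · intro h
    obtain ⟨y, h1, h2⟩ := D.mem_graph_iff.mp h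
    refine (LinearPMap.mem_graph_iff _).mpr ⟨y, h1, ?_⟩
    change (y : H) = u at h1
    change D y = v - M u at h2
    change M y + D y = v
    rw [h2, h1]
    abel

theorem mem_graph_perturb_of_mem {M : H →L[ℂ] H} {u v : H} (h : (u, v) ∈ D.graph) :
    (u, v + M u) ∈ (perturb D M).graph := by
  rw [mem_graph_perturb]
  simpa using h

end CompactResolvent

theorem inner_eq_zero_of_forall_hilbertBasis {V : Submodule ℂ H} {ι : Type*}
    (b : HilbertBasis ι ℂ V) {x : H} (hx : ∀ i, ⟪x, (b i : H)⟫_ℂ = 0) {v : H} (hv : v ∈ V) :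
    ⟪x, v⟫_ℂ = 0 := by
  have h1 := (b.hasSum_repr ⟨v, hv⟩).mapL ((innerSL ℂ x) ∘L V.subtypeL)
  have h2 : ∀ i, ((innerSL ℂ x) ∘L V.subtypeL) (b.repr ⟨v, hv⟩ i • b i) = 0 := by
    intro i
    rw [map_smul]
    change _ • ⟪x, (b i : H)⟫_ℂ = 0
    rw [hx, smul_zero]
  simp only [h2] at h1
  exact h1.unique hasSum_zero

theorem isClosed_eigenspace (R : H →L[ℂ] H) (μ : ℂ) :
    IsClosed (Module.End.eigenspace (R : Module.End ℂ H) μ : Set H) := by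
  have h1 : (Module.End.eigenspace (R : Module.End ℂ H) μ : Set H) = {x | R x = μ • x} := by
    ext x
    exact Module.End.mem_eigenspace_iff
  rw [h1]
  exact isClosed_eq R.continuous (continuous_const_smul μ)

variable [CompleteSpace H] {D : H →ₗ.[ℂ] H}

/-- The bounded operator `D (1 + D²)⁻¹`. -/
def resolventSqMul (D : H →ₗ.[ℂ] H) : H →L[ℂ] H :=
  (WithLp.sndL 2 ℂ H H) ∘L (closedGraph D).starProjection ∘L
    (WithLp.prodContinuousLinearEquiv 2 ℂ H H).symm.toContinuousLinearMap ∘L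
      (ContinuousLinearMap.inl ℂ H H)

theorem resolventSqMul_mem_graph (hD : IsSelfAdjoint D) (x : H) :
    (resolventSq D x, resolventSqMul D x) ∈ D.graph :=
  (mem_closedGraph hD _).mp (Submodule.starProjection_apply_mem _ (WithLp.toLp 2 (x, 0)))

theorem resolventSqMul_mem_graph' (hD : IsSelfAdjoint D) (x : H) :
    (resolventSqMul D x, x - resolventSq D x) ∈ D.graph := by
  obtain ⟨y, h1, h2⟩ := resolventSq_spec hD x
  have h3 : resolventSqMul D x = y := D.mem_graph_snd_inj (resolventSqMul_mem_graph hD x) h1 rfl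
  rwa [h3]

/-- The resolvent `(D - i)⁻¹`. -/
def resolventI (D : H →ₗ.[ℂ] H) : H →L[ℂ] H :=
  resolventSqMul D + Complex.I • resolventSq D

theorem resolventI_mem_graph (hD : IsSelfAdjoint D) (x : H) :
    (resolventI D x, x + Complex.I • resolventI D x) ∈ D.graph := by
  convert D.graph.add_mem (resolventSqMul_mem_graph' hD x)
    (D.graph.smul_mem Complex.I (resolventSqMul_mem_graph hD x)) using 1
  refine Prod.ext rfl ?_
  change x + Complex.I • (resolventSqMul D x + Complex.I • resolventSq D x) =
    x - resolventSq D x + Complex.I • resolventSqMul D x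
  rw [smul_add, smul_smul, Complex.I_mul_I, neg_one_smul]
  abel

theorem hasCompactResolvent_of_isCompactOperator (hD : IsSelfAdjoint D)
    (hc : IsCompactOperator (resolventI D)) : HasCompactResolvent D := by
  refine ⟨Complex.I, resolventI D, hc, fun η => ?_, fun ξ => ?_⟩
  · have h1 := resolventI_mem_graph hD η
    refine ⟨LinearPMap.mem_domain_of_mem_graph h1, ?_⟩
    rw [sub_eq_iff_eq_add]
    exact D.mem_graph_snd_inj (D.mem_graph _) h1 rfl
  · set η := D ξ - Complex.I • (ξ : H) with hη
    have h1 := D.graph.sub_mem (resolventI_mem_graph hD η) (D.mem_graph ξ)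
    -- The discrepancy w satisfies Dw = iw, which symmetry of D allows only for w = 0.
    have h2 : (resolventI D η - ξ, Complex.I • (resolventI D η - ξ)) ∈ D.graph := by
      convert h1 using 1
      refine Prod.ext rfl ?_
      change Complex.I • (resolventI D η - ξ) = η + Complex.I • resolventI D η - D ξ
      rw [hη, smul_sub]
      abel
    have h3 := inner_graph_symm hD h2 h2
    rw [inner_smul_left, inner_smul_right, Complex.conj_I] at h3
    have h4 : (2 * Complex.I) * ⟪resolventI D η - ξ, resolventI D η - ξ⟫_ℂ = 0 := by
      linear_combination -h3
    have h5 : ⟪resolventI D η - ξ, resolventI D η - ξ⟫_ℂ = 0 :=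
      (mul_eq_zero.mp h4).resolve_left (by simp)
    exact sub_eq_zero.mp (inner_self_eq_zero.mp h5)

theorem resolventSq_injective (hD : IsSelfAdjoint D) {x : H} (hx : resolventSq D x = 0) :
    x = 0 := by
  rw [← sqrt_sqrt_apply resolventSq_nonneg] at hx
  exact sqrt_resolventSq_injective hD (sqrt_resolventSq_injective hD hx)

/-- A compact self-adjoint operator has an orthonormal basis of eigenvectors. -/
theorem exists_hilbertBasis_eigenvectors {R : H →L[ℂ] H} (hc : IsCompactOperator R)
    (hR : (R : H →ₗ[ℂ] H).IsSymmetric) :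
    ∃ (ι : Type u) (e : HilbertBasis ι ℂ H) (c : ι → ℂ), ∀ i, R (e i) = c i • e i := by
  have hV : ∀ μ, CompleteSpace (Module.End.eigenspace (R : Module.End ℂ H) μ) :=
    fun μ => (isClosed_eigenspace R μ).completeSpace_coe
  have hex : ∀ μ, ∃ (w : Set (Module.End.eigenspace (R : Module.End ℂ H) μ))
      (_ : HilbertBasis w ℂ (Module.End.eigenspace (R : Module.End ℂ H) μ)), True := fun μ => by
    obtain ⟨w, b, -⟩ := exists_hilbertBasis ℂ (Module.End.eigenspace (R : Module.End ℂ H) μ)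
    exact ⟨w, b, trivial⟩
  choose w b _ using hex
  have hon : Orthonormal ℂ fun a : Σ μ, w μ => (b a.1 a.2 : H) :=
    hR.orthogonalFamily_eigenspaces.orthonormal_sigma_orthonormal (fun μ => (b μ).orthonormal)
  have hbot : (Submodule.span ℂ (Set.range fun a : Σ μ, w μ => (b a.1 a.2 : H)))ᗮ = ⊥ := by
    rw [eq_bot_iff, ← ContinuousLinearMap.orthogonalComplement_iSup_eigenspaces_eq_bot hc hR]
    intro x hx
    rw [Submodule.mem_orthogonal'] at hx ⊢
    intro y hy
    have hle : (⨆ μ, Module.End.eigenspace (R : Module.End ℂ H) μ) ≤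
        LinearMap.ker (innerSL ℂ x).toLinearMap :=
      iSup_le fun μ v hv => inner_eq_zero_of_forall_hilbertBasis (b μ)
        (fun i => hx _ (Submodule.subset_span ⟨⟨μ, i⟩, rfl⟩)) hv
    exact hle hy
  refine ⟨Σ μ, w μ, HilbertBasis.mkOfOrthogonalEqBot hon hbot, fun a => a.1, fun a => ?_⟩
  rw [HilbertBasis.coe_mkOfOrthogonalEqBot]
  exact Module.End.mem_eigenspace_iff.mp (b a.1 a.2).2

/-- A self-adjoint operator `D` with compact resolvent has an orthonormal basis of eigenvectors of
`D²`. -/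
theorem exists_eigenbasis (hD : IsSelfAdjoint D) (hc : HasCompactResolvent D) :
    ∃ (ι : Type u) (e : HilbertBasis ι ℂ H) (ν : ι → ℝ), (∀ i, 0 ≤ ν i) ∧
      ∀ i, ∃ v, (e i, v) ∈ D.graph ∧ (v, (ν i : ℂ) • e i) ∈ D.graph := by
  have hcR : IsCompactOperator (resolventSq D) :=
    isCompactOperator_of_mem_graph hc (resolventSqMul_mem_graph hD)
  obtain ⟨ι, e, c, h⟩ := exists_hilbertBasis_eigenvectors hcR
    ((ContinuousLinearMap.nonneg_iff_isPositive _).mp (resolventSq_nonneg (D := D))).isSymmetric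
  have he : ∀ i, ∃ (ν : ℝ) (v : H), 0 ≤ ν ∧ (e i, v) ∈ D.graph ∧ (v, (ν : ℂ) • e i) ∈ D.graph := by
    intro i
    have hei : ‖e i‖ = 1 := e.orthonormal.1 i
    have hci : c i ≠ 0 := by
      intro h0
      have h1 : e i = 0 := resolventSq_injective hD (by rw [h, h0, zero_smul])
      rw [h1, norm_zero] at hei
      exact zero_ne_one hei
    have h1 := D.graph.smul_mem (c i)⁻¹ (resolventSqMul_mem_graph hD (e i))
    have h2 := D.graph.smul_mem (c i)⁻¹ (resolventSqMul_mem_graph' hD (e i))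
    rw [Prod.smul_mk] at h1 h2
    rw [h, smul_smul, inv_mul_cancel₀ hci, one_smul] at h1
    rw [h, smul_sub, smul_smul, inv_mul_cancel₀ hci, ← sub_smul] at h2
    set v := (c i)⁻¹ • resolventSqMul D (e i)
    -- The eigenvalue c⁻¹ − 1 of D² equals ‖De‖², hence is real and nonnegative.
    have h3 : ((‖v‖ ^ 2 : ℝ) : ℂ) = (c i)⁻¹ - 1 := by
      have h4 := inner_graph_symm hD h2 h1
      rw [inner_self_eq_norm_sq_to_K, inner_smul_right, inner_self_eq_norm_sq_to_K, hei] at h4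
      simpa using h4
    exact ⟨‖v‖ ^ 2, v, sq_nonneg _, h1, by rwa [h3]⟩
  choose ν v hν h1 h2 using he
  exact ⟨ι, e, ν, hν, fun i => ⟨v i, h1 i, h2 i⟩⟩

/-- The vector x = (|D| − √ν)e satisfies |D|x = −√ν x, so positivity of |D| forces x = 0. This says
nothing when ν = 0, where ‖|D|e‖² = ⟪|D|²e, e⟫ = 0 is used instead. -/
theorem modulus_eigenvector (hD : IsSelfAdjoint D) {e v : H} {ν : ℝ} (hν : 0 ≤ ν)
    (h1 : (e, v) ∈ D.graph) (h2 : (v, (ν : ℂ) • e) ∈ D.graph) :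
    (e, ((√ν : ℝ) : ℂ) • e) ∈ (modulus D).graph := by
  obtain ⟨hP, hpos, hsq⟩ := modulus_spec hD
  obtain ⟨v', h3, h4⟩ := (hsq _ _).mpr ⟨v, h1, h2⟩
  suffices h : v' - ((√ν : ℝ) : ℂ) • e = 0 by rwa [sub_eq_zero.mp h] at h3
  rcases hν.eq_or_lt with h0 | h0
  · have h5 := inner_graph_symm hP h4 h3
    rw [← h0] at h5 ⊢
    simpa using h5
  set x := v' - ((√ν : ℝ) : ℂ) • e with hx
  have h5 : (x, -(((√ν : ℝ) : ℂ) • x)) ∈ (modulus D).graph := by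
    convert (modulus D).graph.sub_mem h4 ((modulus D).graph.smul_mem ((√ν : ℝ) : ℂ) h3) using 1
    refine Prod.ext rfl ?_
    change -(((√ν : ℝ) : ℂ) • x) = (ν : ℂ) • e - ((√ν : ℝ) : ℂ) • v'
    rw [hx, smul_sub, smul_smul, ← Complex.ofReal_mul, Real.mul_self_sqrt hν]
    abel
  have h6 := hpos ⟨x, LinearPMap.mem_domain_of_mem_graph h5⟩
  have h7 : modulus D ⟨x, LinearPMap.mem_domain_of_mem_graph h5⟩ = -(((√ν : ℝ) : ℂ) • x) :=
    (modulus D).mem_graph_snd_inj ((modulus D).mem_graph _) h5 rfl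
  rw [h7, inner_neg_right, inner_smul_right, inner_self_eq_norm_sq_to_K] at h6
  have h8 : RCLike.re (-(((√ν : ℝ) : ℂ) * ((‖x‖ : ℝ) : ℂ) ^ 2)) = -(√ν * ‖x‖ ^ 2) := by
    rw [← Complex.ofReal_pow, ← Complex.ofReal_mul, ← Complex.ofReal_neg]
    exact Complex.ofReal_re _
  have h9 : 0 ≤ -(√ν * ‖x‖ ^ 2) := h8 ▸ h6
  have h10 : ‖x‖ ^ 2 = 0 := by
    have := Real.sqrt_pos.mpr h0
    nlinarith [sq_nonneg ‖x‖]
  exact norm_eq_zero.mp (pow_eq_zero_iff two_ne_zero |>.mp h10)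

/-! ### Operators in an eigenbasis -/

section Coordinates

variable {P : H →ₗ.[ℂ] H} {ι : Type*} {e : HilbertBasis ι ℂ H} {p : ι → ℝ}

/-- For the converse, Parseval's identity shows that (u, v) pairs correctly with the whole graph,
hence lies in the graph of the adjoint, which is P. -/
theorem mem_graph_iff_inner (hP : IsSelfAdjoint P) (he : ∀ i, (e i, (p i : ℂ) • e i) ∈ P.graph)
    {u v : H} : (u, v) ∈ P.graph ↔ ∀ i, ⟪e i, v⟫_ℂ = p i * ⟪e i, u⟫_ℂ := by
  have key : ∀ {u v : H}, (u, v) ∈ P.graph → ∀ i, ⟪e i, v⟫_ℂ = p i * ⟪e i, u⟫_ℂ := by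
    intro u v h i
    have := inner_graph_symm hP h (he i)
    rwa [inner_smul_left, Complex.conj_ofReal, eq_comm] at this
  refine ⟨key, fun h => mem_graph_of_forall hP fun a b hab => ?_⟩
  refine (e.hasSum_inner_mul_inner b u).unique ?_
  convert e.hasSum_inner_mul_inner a v using 2 with i
  rw [h i, ← inner_conj_symm b, ← inner_conj_symm a, key hab, map_mul, Complex.conj_ofReal]
  ring

theorem hasSum_inner_apply (e : HilbertBasis ι ℂ H) (T : H →L[ℂ] H) (x ξ : H) :
    HasSum (fun j => ⟪x, T (e j)⟫_ℂ * ⟪e j, ξ⟫_ℂ) ⟪x, T ξ⟫_ℂ := by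
  simpa only [ContinuousLinearMap.adjoint_inner_left] using
    e.hasSum_inner_mul_inner (T.adjoint x) ξ

theorem hasBoundedCommutator_of_matrix (hP : IsSelfAdjoint P)
    (he : ∀ i, (e i, (p i : ℂ) • e i) ∈ P.graph) {T S : H →L[ℂ] H}
    (h : ∀ i j, ⟪e i, S (e j)⟫_ℂ = ((p i - p j : ℝ) : ℂ) * ⟪e i, T (e j)⟫_ℂ) :
    HasBoundedCommutator P T S := by
  refine hasBoundedCommutator_iff.mpr fun u v huv => (mem_graph_iff_inner hP he).mpr fun i => ?_
  rw [mem_graph_iff_inner hP he] at huv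
  rw [inner_add_right]
  have h1 := (hasSum_inner_apply e T (e i) v).add (hasSum_inner_apply e S (e i) u)
  have h2 : ∀ j, ⟪e i, T (e j)⟫_ℂ * ⟪e j, v⟫_ℂ + ⟪e i, S (e j)⟫_ℂ * ⟪e j, u⟫_ℂ =
      p i * (⟪e i, T (e j)⟫_ℂ * ⟪e j, u⟫_ℂ) := by
    intro j
    rw [h, huv j]
    push_cast
    ring
  simp only [h2] at h1
  exact h1.unique ((hasSum_inner_apply e T (e i) u).mul_left (p i : ℂ))

/-- The case n = 1 produces the operator δ(T); its iterated commutator matrices are those of T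
shifted by one, so the induction continues. -/
theorem memDomDelta_of_matrix {D : H →ₗ.[ℂ] H} (hD : IsSelfAdjoint D)
    (he : ∀ i, (e i, (p i : ℂ) • e i) ∈ (modulus D).graph) {T : H →L[ℂ] H}
    (h : ∀ n : ℕ, IsBoundedMatrix fun i j => ((p i - p j : ℝ) : ℂ) ^ n * ⟪e i, T (e j)⟫_ℂ)
    (n : ℕ) : MemDomDelta D n T := by
  induction n generalizing T with
  | zero => trivial
  | succ n ih =>
    obtain ⟨S, hS⟩ := (h 1).exists_operator e
    simp only [pow_one] at hS
    refine ⟨S, hasBoundedCommutator_of_matrix (modulus_spec hD).1 he hS, ih fun k => ?_⟩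
    convert h (k + 1) using 3 with i j
    rw [hS]
    ring

end Coordinates

/-! ### Bounded self-adjoint perturbations -/

section Perturbation

variable {M : H →L[ℂ] H}

theorem isSelfAdjoint_perturb (hD : IsSelfAdjoint D) (hM : IsSelfAdjoint M) :
    IsSelfAdjoint (perturb D M) := by
  have hM' : ∀ x y, ⟪M x, y⟫_ℂ = ⟪x, M y⟫_ℂ := hM.isSymmetric
  rw [LinearPMap.isSelfAdjoint_def]
  apply LinearPMap.eq_of_eq_graph
  have hd : Dense ((perturb D M).domain : Set H) := hD.dense_domain
  rw [LinearPMap.adjoint_graph_eq_graph_adjoint hd]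
  ext ⟨u, v⟩
  rw [Submodule.mem_adjoint_iff]
  constructor
  · intro h
    rw [mem_graph_perturb]
    refine mem_graph_of_forall hD fun a b hab => ?_
    have h1 := h _ _ (mem_graph_perturb_of_mem (M := M) hab)
    rw [sub_eq_zero, inner_add_left, hM'] at h1
    rw [inner_sub_right, ← h1]
    abel
  · intro h a b hab
    rw [mem_graph_perturb] at h hab
    have h1 := inner_graph_symm hD h hab
    rw [inner_sub_left, inner_sub_right, hM'] at h1
    linear_combination h1

theorem hasCompactResolvent_perturb (hD : IsSelfAdjoint D) (hc : HasCompactResolvent D)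
    (hM : IsSelfAdjoint M) : HasCompactResolvent (perturb D M) := by
  have hE := isSelfAdjoint_perturb hD hM
  refine hasCompactResolvent_of_isCompactOperator hE ?_
  -- For R' = (D + M − i)⁻¹ the choice of B is DR' = 1 + iR' − MR'.
  refine isCompactOperator_of_mem_graph hc
    (B := 1 + Complex.I • resolventI (perturb D M) - M * resolventI (perturb D M)) fun x => ?_
  exact mem_graph_perturb.mp (resolventI_mem_graph hE x)

/-- One inclusion is dom (D + M)ᵏ ⊆ dom Dᵏ by induction; the other holds because H^∞ is stable under
D + M. -/
theorem smooth_perturb (h : ∀ k, ∀ u ∈ domPow D k, M u ∈ domPow D k) :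
    smooth (perturb D M) = smooth D := by
  apply le_antisymm
  · have key : ∀ k, domPow (perturb D M) k ≤ domPow D k := by
      intro k
      induction k with
      | zero => exact le_rfl
      | succ k ih =>
        intro u hu
        have h1 := h k u (ih (domPow_succ_le k hu))
        obtain ⟨v, huv, hv⟩ := mem_domPow_succ.mp hu
        exact mem_domPow_succ.mpr ⟨_, mem_graph_perturb.mp huv, Submodule.sub_mem _ (ih hv) h1⟩
    exact fun u hu => mem_smooth.mpr fun k => key k (mem_smooth.mp hu k)
  · refine le_smooth fun u hu => ?_
    refine ⟨_, ?_, mem_graph_perturb_of_mem (smoothOp_mem_graph ⟨u, hu⟩)⟩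
    exact Submodule.add_mem _ (Subtype.prop _)
      (mem_smooth.mpr fun k => h k u (mem_smooth.mp hu k))

theorem HasBoundedCommutator.perturb {T S : H →L[ℂ] H} (h : HasBoundedCommutator D T S) :
    HasBoundedCommutator (perturb D M) T (S + (M * T - T * M)) := by
  rw [hasBoundedCommutator_iff] at *
  intro u v huv
  rw [mem_graph_perturb] at huv ⊢
  convert h _ _ huv using 1
  refine Prod.ext rfl ?_
  change T v + (S u + (M (T u) - T (M u))) - M (T u) = T (v - M u) + S u
  rw [map_sub]
  abel

end Perturbation

end NCG

end

noncomputable section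

namespace NCG

/-! ### Regularity of the perturbed triple -/

theorem exists_end_of_submodule_eq {V : Type*} [AddCommGroup V] [Module ℂ V]
    {W W' : Submodule ℂ V} (h : W = W') (Y : Module.End ℂ W) :
    ∃ X : Module.End ℂ W', ∀ ξ : W', (X ξ : V) = Y ⟨ξ, h.ge ξ.2⟩ := by
  subst h
  exact ⟨Y, fun _ => rfl⟩

variable {H : Type*} [NormedAddCommGroup H] [InnerProductSpace ℂ H] [CompleteSpace H]
  {D : H →ₗ.[ℂ] H} {M : H →L[ℂ] H} {m : Module.End ℂ (smooth D)}

theorem dense_smooth (hD : IsSelfAdjoint D) (hc : HasCompactResolvent D) :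
    Dense (smooth D : Set H) := by
  obtain ⟨ι, e, ν, -, he⟩ := exists_eigenbasis hD hc
  have h1 : Submodule.span ℂ (Set.range e) ≤ smooth D := by
    rw [Submodule.span_le]
    rintro _ ⟨i, rfl⟩
    obtain ⟨v, h1, h2⟩ := he i
    exact mem_smooth.mpr fun k => (mem_domPow_of_sq_eigenvector h1 h2 k).1
  have h2 : Dense (Submodule.span ℂ (Set.range e) : Set H) :=
    Submodule.dense_iff_topologicalClosure_eq_top.mpr e.dense_span
  exact h2.mono h1

theorem IsRestriction.unique (hd : Dense (smooth D : Set H)) {X : Module.End ℂ (smooth D)}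
    {T S : H →L[ℂ] H} (hT : IsRestriction X T) (hS : IsRestriction X S) : T = S :=
  DFunLike.coe_injective (T.continuous.ext_on hd S.continuous fun u hu =>
    (hT ⟨u, hu⟩).symm.trans (hS ⟨u, hu⟩))

theorem forall_memDomDelta_of_isRestriction (hd : Dense (smooth D : Set H))
    (hm : m ∈ deltaSmooth D) (hM : IsRestriction m M) (n : ℕ) : MemDomDelta D n M := by
  obtain ⟨T, h1, h2⟩ := hm
  rw [hM.unique hd h1]
  exact h2 n

theorem transportOp_perturb (hM : IsRestriction m M) (h : smooth (perturb D M) = smooth D) :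
    transportOp h = smoothOp D + m := by
  ext ξ
  have h1 := mem_graph_perturb_of_mem (M := M) (smoothOp_mem_graph ξ)
  rw [LinearMap.add_apply, Submodule.coe_add, hM]
  exact LinearPMap.mem_graph_snd_inj _ (transportOp_mem_graph h ξ) h1 rfl

theorem exists_norm_apply_le_perturb (hD : IsSelfAdjoint D) (hm : m ∈ deltaSmooth D) {k : ℕ}
    {Y : Module.End ℂ (smooth D)} (hY : Y ∈ orderFiltration (deltaSmooth D) (absOp hD) k) :
    ∃ C, 0 ≤ C ∧ ∀ ξ, ‖Y ξ‖ ≤ C * ∑ j ∈ Finset.range (k + 1), ‖((smoothOp D + m) ^ j) ξ‖ := by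
  obtain ⟨C, hC, h⟩ := exists_norm_apply_le hD hY
  choose C' hC' h' using exists_norm_pow_le hD hm
  refine ⟨C * ∑ j ∈ Finset.range (k + 1), C' j,
    mul_nonneg hC (Finset.sum_nonneg fun j _ => hC' j), fun ξ => (h ξ).trans ?_⟩
  rw [mul_assoc, Finset.sum_mul]
  refine mul_le_mul_of_nonneg_left (Finset.sum_le_sum fun j hj => (h' j ξ).trans ?_) hC
  refine mul_le_mul_of_nonneg_left (Finset.sum_le_sum_of_subset_of_nonneg
    (Finset.range_mono ?_) fun _ _ _ => norm_nonneg _) (hC' j)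
  have := Finset.mem_range.mp hj
  omega

/-! ### Iterated commutators in an eigenbasis of S² -/

section Eigenvectors

variable {ι : Type*} {S : Module.End ℂ (smooth D)} {e : ι → smooth D} {ν : ι → ℝ}

theorem inner_commMap_pow (hS : S.IsSymmetric) (he : ∀ i, (S ^ 2) (e i) = (ν i : ℂ) • e i)
    (X : Module.End ℂ (smooth D)) (n : ℕ) (i j : ι) :
    ⟪e i, ((commMap (S ^ 2) ^ n) X) (e j)⟫_ℂ =
      ((ν i - ν j : ℝ) : ℂ) ^ n * ⟪e i, X (e j)⟫_ℂ := by
  induction n with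
  | zero => simp
  | succ n ih =>
    rw [pow_succ' (commMap (S ^ 2)), Module.End.mul_apply]
    generalize (commMap (S ^ 2) ^ n) X = Y at ih ⊢
    have h1 : (commMap (S ^ 2) Y) (e j) = (S ^ 2) (Y (e j)) - (ν j : ℂ) • Y (e j) := by
      rw [← map_smul, ← he j]
      rfl
    rw [h1, inner_sub_right, ← (hS.pow 2) (e i), he, inner_smul_left, inner_smul_right,
      Complex.conj_ofReal, ih]
    push_cast
    ring

/-- On the span of the eigenvectors, Sʲ(1 + S²)^{−n/2} is a contraction for j ≤ n, because νʲ ≤ (1 +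
ν)ⁿ. -/
theorem norm_pow_sum_le (hon : Orthonormal ℂ e) (hS : S.IsSymmetric)
    (he : ∀ i, (S ^ 2) (e i) = (ν i : ℂ) • e i) (hν : ∀ i, 0 ≤ ν i) {j n : ℕ} (hj : j ≤ n)
    (F : Finset ι) (y : ι → ℂ) :
    ‖(S ^ j) (∑ i ∈ F, (((√(1 + ν i))⁻¹ : ℝ) : ℂ) ^ n • y i • e i)‖ ≤ ‖∑ i ∈ F, y i • e i‖ := by
  have hpow : ∀ i, (S ^ (j + j)) (e i) = ((ν i ^ j : ℝ) : ℂ) • e i := by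
    intro i
    rw [← two_mul, pow_mul]
    clear hj
    induction j with
    | zero => simp
    | succ j ih =>
      rw [pow_succ, Module.End.mul_apply, he, map_smul, ih, smul_smul, ← Complex.ofReal_mul,
        pow_succ']
  refine (pow_le_pow_iff_left₀ (norm_nonneg _) (norm_nonneg _) two_ne_zero).mp ?_
  rw [← inner_self_eq_norm_sq (𝕜 := ℂ), ← inner_self_eq_norm_sq (𝕜 := ℂ), hS.pow j,
    ← Module.End.mul_apply, ← pow_add, map_sum]
  simp only [smul_smul, map_smul, hpow]
  rw [hon.inner_sum, hon.inner_sum, map_sum, map_sum]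
  refine Finset.sum_le_sum fun i _ => ?_
  set q := √(1 + ν i) with hq
  have hq2 : q ^ 2 = 1 + ν i := Real.sq_sqrt (by have := hν i; linarith)
  have hq1 : 1 ≤ q ^ 2 := by have := hν i; linarith
  have hq0 : q ≠ 0 := by
    rintro h0
    rw [h0] at hq1
    norm_num at hq1
  have h1 : starRingEnd ℂ (((q⁻¹ : ℝ) : ℂ) ^ n * y i) *
      (((q⁻¹ : ℝ) : ℂ) ^ n * y i * ((ν i ^ j : ℝ) : ℂ)) =
      ((ν i ^ j / (q ^ 2) ^ n * ‖y i‖ ^ 2 : ℝ) : ℂ) := by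
    have h2 : starRingEnd ℂ (y i) * y i = ((‖y i‖ ^ 2 : ℝ) : ℂ) := by
      rw [RCLike.conj_mul]; norm_cast
    rw [map_mul, map_pow, Complex.conj_ofReal, Complex.ofReal_mul, ← h2]
    push_cast
    rw [inv_pow, div_eq_mul_inv, ← pow_mul, two_mul, pow_add, mul_inv]
    ring
  have h3 : starRingEnd ℂ (y i) * y i = ((‖y i‖ ^ 2 : ℝ) : ℂ) := by
    rw [RCLike.conj_mul]; norm_cast
  rw [h1, h3]
  change ν i ^ j / (q ^ 2) ^ n * ‖y i‖ ^ 2 ≤ ‖y i‖ ^ 2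
  refine mul_le_of_le_one_left (sq_nonneg _) ((div_le_one (by positivity)).mpr ?_)
  exact (pow_le_pow_left₀ (hν i) (by linarith) j).trans (pow_le_pow_right₀ hq1 hj)

/-- The matrix is that of the n-th commutator of S² with X, times (1 + S²)^{−n/2} on the right. This
factor makes each of the n + 1 terms of the elliptic estimate at most the norm of the vector. -/
theorem isBoundedMatrix_commMap (hon : Orthonormal ℂ e) (hS : S.IsSymmetric)
    (he : ∀ i, (S ^ 2) (e i) = (ν i : ℂ) • e i) (hν : ∀ i, 0 ≤ ν i)
    {X : Module.End ℂ (smooth D)} {n : ℕ} {C : ℝ} (hC : 0 ≤ C)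
    (hX : ∀ ξ, ‖((commMap (S ^ 2) ^ n) X) ξ‖ ≤ C * ∑ j ∈ Finset.range (n + 1), ‖(S ^ j) ξ‖) :
    IsBoundedMatrix fun i j => (((ν i - ν j) / √(1 + ν j) : ℝ) : ℂ) ^ n * ⟪e i, X (e j)⟫_ℂ := by
  refine isBoundedMatrix_of_apply e hon (C := C * (n + 1)) fun F x y => ?_
  set η := ∑ i ∈ F, (((√(1 + ν i))⁻¹ : ℝ) : ℂ) ^ n • y i • e i with hη
  have h1 : ∑ i ∈ F, ∑ j ∈ F, starRingEnd ℂ (x i) *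
      ((((ν i - ν j) / √(1 + ν j) : ℝ) : ℂ) ^ n * ⟪e i, X (e j)⟫_ℂ) * y j =
      ⟪∑ i ∈ F, x i • e i, ((commMap (S ^ 2) ^ n) X) η⟫_ℂ := by
    rw [sum_inner]
    refine Finset.sum_congr rfl fun i _ => ?_
    rw [hη, map_sum, inner_sum]
    refine Finset.sum_congr rfl fun j _ => ?_
    rw [map_smul, map_smul, inner_smul_left, inner_smul_right, inner_smul_right,
      inner_commMap_pow hS he, div_eq_mul_inv, Complex.ofReal_mul, mul_pow]
    ring
  rw [h1]
  refine (norm_inner_le_norm _ _).trans ?_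
  have h2 : ∑ j ∈ Finset.range (n + 1), ‖(S ^ j) η‖ ≤ (n + 1) * ‖∑ i ∈ F, y i • e i‖ := by
    refine (Finset.sum_le_card_nsmul _ _ ‖∑ i ∈ F, y i • e i‖ fun j hj => ?_).trans_eq ?_
    · exact norm_pow_sum_le hon hS he hν (Nat.lt_succ_iff.mp (Finset.mem_range.mp hj)) F y
    · rw [Finset.card_range, nsmul_eq_mul]
      push_cast
      rfl
  refine (mul_le_mul_of_nonneg_left ((hX η).trans (mul_le_mul_of_nonneg_left h2 hC))
    (norm_nonneg _)).trans_eq ?_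
  ring

end Eigenvectors

variable {D₀ : Subalgebra ℂ (Module.End ℂ (smooth D))}

/-- The perturbed operator has the same smooth vectors. -/
theorem smooth_perturb_eq (hD : IsSelfAdjoint D) (hc : HasCompactResolvent D)
    (hmR : IsRestriction m M) (hm : m ∈ deltaSmooth D) : smooth (perturb D M) = smooth D :=
  smooth_perturb fun _ _ hu =>
    apply_mem_domPow hD (forall_memDomDelta_of_isRestriction (dense_smooth hD hc) hm hmR) hu

/-- The operators of order zero are smooth for the perturbed derivation. -/
theorem memDomDelta_perturb (hD : IsSelfAdjoint D) (hc : HasCompactResolvent D)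
    (hM : IsSelfAdjoint M) (hmR : IsRestriction m M) (hD₀ : D₀ ≤ deltaSmooth D) (hm : m ∈ D₀)
    (h : ∀ k, ∀ T ∈ diffOrder D D₀ k,
      commMap ((smoothOp D + m) ^ 2 - smoothOp D ^ 2) T ∈ diffOrder D D₀ (k + 1))
    {X : Module.End ℂ (smooth D)} (hX : X ∈ D₀) {T : H →L[ℂ] H} (hT : IsRestriction X T) (n : ℕ) :
    MemDomDelta (perturb D M) n T := by
  have hE := isSelfAdjoint_perturb hD hM
  have hsm := smooth_perturb_eq hD hc hmR (hD₀ hm)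
  obtain ⟨ι, e, ν, hν, he⟩ := exists_eigenbasis hE (hasCompactResolvent_perturb hD hc hM)
  choose v hv1 hv2 using he
  let e' : ι → smooth D := fun i => ⟨e i, hsm.le
    (mem_smooth.mpr fun k => (mem_domPow_of_sq_eigenvector (hv1 i) (hv2 i) k).1)⟩
  have hS : (smoothOp D + m).IsSymmetric := by
    rw [← transportOp_perturb hmR hsm]
    exact fun ξ η => inner_graph_symm hE (transportOp_mem_graph hsm η) (transportOp_mem_graph hsm ξ)
  have he' : ∀ i, ((smoothOp D + m) ^ 2) (e' i) = (ν i : ℂ) • e' i := by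
    intro i
    rw [← transportOp_perturb hmR hsm, pow_two, Module.End.mul_apply]
    have h1 : (transportOp hsm (e' i) : H) = v i :=
      LinearPMap.mem_graph_snd_inj _ (transportOp_mem_graph hsm (e' i)) (hv1 i) rfl
    exact Subtype.ext (LinearPMap.mem_graph_snd_inj _
      (transportOp_mem_graph hsm (transportOp hsm (e' i))) (hv2 i) h1)
  have hon : Orthonormal ℂ e' :=
    (LinearIsometry.orthonormal_comp_iff (smooth D).subtypeₗᵢ).mp e.orthonormal
  -- The elliptic estimate for the n-th commutator with (D + m)². The weight is √(1 + ν), not √ν, so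
  -- that it stays at least 1 even when D + M has a kernel.
  have hmat : ∀ n : ℕ, IsBoundedMatrix fun i j =>
      (((ν i - ν j) / √(1 + ν j) : ℝ) : ℂ) ^ n * ⟪e i, T (e j)⟫_ℂ := by
    intro n
    obtain ⟨C, hC, hb⟩ := exists_norm_apply_le_perturb hD (hD₀ hm)
      (diffOrder_le hD hD₀ n (commMap_pow_mem_diffOrder h hX n))
    have h1 := isBoundedMatrix_commMap hon hS he' hν hC hb
    have h2 : ∀ i j, ⟪e' i, X (e' j)⟫_ℂ = ⟪e i, T (e j)⟫_ℂ := fun i j => by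
      rw [Submodule.coe_inner, hT]
    simpa only [h2] using h1
  have hsq : ∀ i, √(1 + ν i) ^ 2 = 1 + ν i := fun i => Real.sq_sqrt (by have := hν i; linarith)
  have hq : ∀ i, 1 ≤ √(1 + ν i) := fun i => Real.one_le_sqrt.mpr (by have := hν i; linarith)
  have hpq : ∀ i, |√(1 + ν i) - √(ν i)| ≤ 1 := by
    intro i
    have h1 := Real.sqrt_le_sqrt (show ν i ≤ 1 + ν i by linarith)
    have h2 : √(1 + ν i) ≤ 1 + √(ν i) := by
      refine Real.sqrt_le_iff.mpr ⟨by positivity, ?_⟩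
      nlinarith [Real.sq_sqrt (hν i), Real.sqrt_nonneg (ν i)]
    rw [abs_of_nonneg (by linarith)]
    linarith
  -- Read backwards: from commutators with E² = Q² − 1 to those with Q, then to those with |E|, for
  -- E = D + M.
  refine memDomDelta_of_matrix hE (e := e) (p := fun i => √(ν i))
    (fun i => modulus_eigenvector hE (hν i) (hv1 i) (hv2 i)) ?_ n
  refine isBoundedMatrix_commutator_of_sub_bounded hpq ?_
  refine isBoundedMatrix_commutator_of_sq hq fun n => ?_
  simp only [hsq, add_sub_add_left_eq_sub]
  exact hmat n

/-! ### Regularity and strong regularity -/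

section SpectralTriple

variable {A : StarSubalgebra ℝ (H →L[ℂ] H)}

theorem algOps_le_deltaSmooth (h : IsRegular A D) {X : Module.End ℂ (smooth D)}
    (hX : X ∈ algOps A D) : X ∈ deltaSmooth D := by
  obtain ⟨a, ha, hXa⟩ := hX
  exact ⟨a, hXa, h.alg_smooth a ha⟩

theorem isRestriction_commutator {X : Module.End ℂ (smooth D)} {T S : H →L[ℂ] H}
    (hX : IsRestriction X T) (hS : HasBoundedCommutator D T S) :
    IsRestriction (smoothOp D * X - X * smoothOp D) S := by
  intro ξ
  have h1 := hasBoundedCommutator_iff.mp hS _ _ (smoothOp_mem_graph ξ)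
  have h2 : T (smoothOp D ξ) + S ξ = smoothOp D (X ξ) :=
    D.mem_graph_snd_inj h1 (smoothOp_mem_graph (X ξ)) (hX ξ).symm
  rw [LinearMap.sub_apply, Submodule.coe_sub, Module.End.mul_apply, Module.End.mul_apply, hX, ← h2]
  abel

theorem diffGens_subset_deltaSmooth (h : IsRegular A D) :
    diffGens A D ⊆ (deltaSmooth D : Set (Module.End ℂ (smooth D))) := by
  rintro X (hX | ⟨X, hX, rfl⟩)
  · exact algOps_le_deltaSmooth h hX
  · obtain ⟨a, ha, hXa⟩ := hX
    obtain ⟨S, hS⟩ := h.bounded_commutator a ha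
    exact ⟨S, isRestriction_commutator hXa hS, h.commutator_smooth a ha S hS⟩

theorem diffZero_le_deltaSmooth (h : IsRegular A D) : diffZero A D ≤ deltaSmooth D :=
  Algebra.adjoin_le (diffGens_subset_deltaSmooth h)

theorem extDiffZero_le_deltaSmooth (h : IsStronglyRegular A D) : extDiffZero A D ≤ deltaSmooth D :=
  Algebra.adjoin_le (Set.union_subset (diffGens_subset_deltaSmooth h.toIsRegular)
    fun X hX => h.endo_smooth X hX)

/-- The algebra D₀ is left general so that both the plain and the extended version are covered. -/
theorem isRegular_perturb (h : IsRegular A D) (hM : IsSelfAdjoint M) (hmR : IsRestriction m M)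
    (hD₀ : D₀ ≤ deltaSmooth D) (hgen : diffGens A D ⊆ (D₀ : Set (Module.End ℂ (smooth D))))
    (hm : m ∈ D₀)
    (hcomm : ∀ k, ∀ T ∈ diffOrder D D₀ k,
      commMap ((smoothOp D + m) ^ 2 - smoothOp D ^ 2) T ∈ diffOrder D D₀ (k + 1)) :
    IsRegular A (perturb D M) := by
  have hD := h.isSelfAdjoint
  have hc := h.hasCompactResolvent
  have hE := isSelfAdjoint_perturb hD hM
  have hdelta : ∀ {X : Module.End ℂ (smooth D)}, X ∈ D₀ → ∀ {T : H →L[ℂ] H}, IsRestriction X T →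
      ∀ n, MemDomDelta (perturb D M) n T := fun hX _ hT n =>
    memDomDelta_perturb hD hc hM hmR hD₀ hm hcomm hX hT n
  have halg : ∀ a ∈ A, ∃ X ∈ algOps A D, IsRestriction X a := fun a ha => by
    obtain ⟨X, hX⟩ := exists_isRestriction_of_memDomDelta hD (h.alg_smooth a ha)
    exact ⟨X, ⟨a, ha, hX⟩, hX⟩
  refine ⟨⟨hE, hasCompactResolvent_perturb hD hc hM, fun a ha => ?_⟩, fun a ha => ?_,
    fun a ha S hS => ?_⟩
  · obtain ⟨S, hS⟩ := h.bounded_commutator a ha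
    exact ⟨_, hS.perturb⟩
  · obtain ⟨X, hXA, hX⟩ := halg a ha
    exact hdelta (hgen (Or.inl hXA)) hX
  · obtain ⟨X, hXA, hX⟩ := halg a ha
    obtain ⟨S', hS'⟩ := h.bounded_commutator a ha
    rw [hS.unique hE.dense_domain hS'.perturb]
    have h1 : smoothOp D * X - X * smoothOp D ∈ D₀ := hgen (Or.inr ⟨X, hXA, rfl⟩)
    have h2 : X ∈ D₀ := hgen (Or.inl hXA)
    -- [D + M, a] = [D, a] + [M, a] stays in D₀ because m does.
    refine hdelta (X := smoothOp D * X - X * smoothOp D + (m * X - X * m))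
      (D₀.add_mem h1 (D₀.sub_mem (D₀.mul_mem hm h2) (D₀.mul_mem h2 hm))) fun ξ => ?_
    have h3 := isRestriction_commutator hX hS' ξ
    rw [LinearMap.add_apply, Submodule.coe_add, h3, LinearMap.sub_apply, Submodule.coe_sub,
      Module.End.mul_apply, Module.End.mul_apply, hmR, hX, hX, hmR]
    rfl

/-- A-linearity on H^∞ involves the operator only through its space of smooth vectors. -/
theorem exists_mem_endoOps_of_smooth_eq {E : H →ₗ.[ℂ] H} (hsm : smooth E = smooth D)
    {Y : Module.End ℂ (smooth E)} (hY : Y ∈ endoOps A E) :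
    ∃ X ∈ endoOps A D, ∀ T : H →L[ℂ] H, IsRestriction X T → IsRestriction Y T := by
  obtain ⟨X, hX⟩ := exists_end_of_submodule_eq hsm Y
  refine ⟨X, fun a ha ξ η hη => ?_, fun T hT ξ => ?_⟩
  · rw [hX, hX]
    exact hY a ha _ _ hη
  · exact (hX ⟨ξ, hsm.le ξ.2⟩).symm.trans (hT _)

theorem isStronglyRegular_perturb (h : IsStronglyRegular A D) (hM : IsSelfAdjoint M)
    (hmR : IsRestriction m M) (hm : m ∈ extDiffZero A D)
    (hcomm : ∀ k, ∀ T ∈ diffOrder D (extDiffZero A D) k,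
      commMap ((smoothOp D + m) ^ 2 - smoothOp D ^ 2) T ∈ diffOrder D (extDiffZero A D) (k + 1)) :
    IsStronglyRegular A (perturb D M) := by
  have hD := h.isSelfAdjoint
  have hc := h.hasCompactResolvent
  have hle := extDiffZero_le_deltaSmooth h
  have hgen : diffGens A D ⊆ (extDiffZero A D : Set (Module.End ℂ (smooth D))) :=
    Set.subset_union_left.trans Algebra.subset_adjoin
  have hendo : ∀ X ∈ endoOps A D, X ∈ extDiffZero A D := fun X hX =>
    Algebra.subset_adjoin (Set.mem_union_right _ hX)
  have hreg := isRegular_perturb h.toIsRegular hM hmR hle hgen hm hcomm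
  refine ⟨hreg, fun Y hY => ?_⟩
  obtain ⟨X, hX, hXY⟩ :=
    exists_mem_endoOps_of_smooth_eq (smooth_perturb_eq hD hc hmR (hle hm)) hY
  -- Only the bounded extension is taken from the original triple; its smoothness for the new
  -- modulus comes from X having order zero.
  obtain ⟨T, hT, -⟩ := h.endo_smooth X hX
  exact ⟨T, hXY T hT, memDomDelta_perturb hD hc hM hmR hle hm hcomm (hendo X hX) hT⟩

end SpectralTriple

end NCG

end

theorem mainTheorem7 {H : Type*} [NormedAddCommGroup H] [InnerProductSpace ℂ H] [CompleteSpace H]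
    (A : StarSubalgebra ℝ (H →L[ℂ] H)) (D : H →ₗ.[ℂ] H)
    (M : H →L[ℂ] H) (hM : IsSelfAdjoint M)
    (m : Module.End ℂ (NCG.smooth D)) (hm : NCG.IsRestriction m M) :
    (NCG.IsRegular A D → m ∈ NCG.diffZero A D →
      (∀ k, ∀ T ∈ NCG.diffOrder D (NCG.diffZero A D) k,
        NCG.commMap ((NCG.smoothOp D + m) ^ 2 - NCG.smoothOp D ^ 2) T ∈
          NCG.diffOrder D (NCG.diffZero A D) (k + 1)) →
      NCG.IsRegular A (NCG.perturb D M)) ∧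
    (NCG.IsStronglyRegular A D → m ∈ NCG.extDiffZero A D →
      (∀ k, ∀ T ∈ NCG.diffOrder D (NCG.extDiffZero A D) k,
        NCG.commMap ((NCG.smoothOp D + m) ^ 2 - NCG.smoothOp D ^ 2) T ∈
          NCG.diffOrder D (NCG.extDiffZero A D) (k + 1)) →
      NCG.IsStronglyRegular A (NCG.perturb D M)) :=
  ⟨fun h hm₀ hcomm => NCG.isRegular_perturb h hM hm (NCG.diffZero_le_deltaSmooth h)
    Algebra.subset_adjoin hm₀ hcomm,
   fun h hm₀ hcomm => NCG.isStronglyRegular_perturb h hM hm hm₀ hcomm⟩
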